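/- Let $n\ge 0$ and let $\rho$ be a state on $L^2(\mathbb{R}^n,dx)=L^2(\mathbb{R}^n,dx;\mathbb{C})$, i.e. a positive bounded operator with finite trace $\tau(\rho)$; let $\|\rho\|_\infty$ be its operator norm on $L^2$ (with the convention $0\cdot\ln 0=0$ if $\rho=0$). Let $\mathrm{vol}^*$ be the measure $d^*\xi=(2\pi)^{-n}d\xi$ on $\mathbb{R}^n$, so that $\widehat f(\xi)=\int e^{-i\langle x,\xi\rangle}f(x)\,dx$ extends to a unitary map $L^2(\mathbb{R}^n,dx)\to L^2(\mathbb{R}^n,d^*\xi)$, and let $\widehat\rho$ be the operator on $L^2(\mathbb{R}^n,d^*\xi)$ defined by $\widehat\rho(\widehat f)=\widehat{\rho(f)}$. For a positive bounded operator $P$ on $L^2(X,\mu)$ let $\nu_P$ be the measure $\nu_P(\Omega)=\tau(P^{1/2}\chi_\Omega P^{1/2})$ on $X$, where $\chi_\Omega$ is multiplication by the indicator function of $\Omega$. Put $$F_{\widehat\rho}(y)=\mathrm{vol}^*\Bigl(\Bigl\{\xi\in\mathbb{R}^n : \frac{d\nu_{\widehat\rho}}{d^*\xi}(\xi)\ge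 y\Bigr\}\Bigr)\quad(y>0),\qquad S_F(\widehat\rho)=\int_0^{+\infty}\ln\bigl(F_{\widehat\rho}(y)\bigr)\,F_{\widehat\rho}(y)\,dy,$$ $$S_x(\rho)=-\int_{\mathbb{R}^n}\ln\Bigl(\frac{d\nu_\rho}{dx}\Bigr)\,d\nu_\rho(x).$$ Suppose that the positive part of the integral $S_F(\widehat\rho)$ is finite, so that $S_F(\widehat\rho)\in[-\infty,+\infty)$. Then the negative part of the integral $S_x(\rho)$ is finite, so that $S_x(\rho)\in(-\infty,+\infty]$, and $$S_x(\rho)+S_F(\widehat\rho)\ \ge\ -\tau(\rho)\,\bigl(2+\ln\|\rho\|_\infty\bigr).$$ If $S_F(\widehat\rho)=-\infty$, the inequality is understood as $S_x(\rho)\ge-\tau(\rho)(2+\ln\|\rho\|_\infty)-S_F(\widehat\rho)$, i.e. as $S_x(\rho)=+\infty$. -/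

import Mathlib

open MeasureTheory Set
open scoped ENNReal FourierTransform SchwartzMap

noncomputable section

namespace StateEntropy

/-! ### Trace and states on a complex Hilbert space -/

/-- The index set of a chosen Hilbert basis of `H`. -/
def basisIndex (H : Type*) [NormedAddCommGroup H] [InnerProductSpace ℂ H] [CompleteSpace H] :
    Set H :=
  (exists_hilbertBasis ℂ H).choose

/-- A chosen Hilbert basis of `H`. -/
def stdBasis (H : Type*) [NormedAddCommGroup H] [InnerProductSpace ℂ H] [CompleteSpace H] :
    HilbertBasis (basisIndex H) ℂ H :=
  (exists_hilbertBasis ℂ H).choose_spec.choose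

/-- The trace `τ(T) = ∑ i, ⟪e i, T (e i)⟫ ∈ [0, ∞]` of a positive bounded operator `T`, computed in
a Hilbert basis; see `opTrace_eq_tsum` for the independence of the basis. -/
def opTrace {H : Type*} [NormedAddCommGroup H] [InnerProductSpace ℂ H] [CompleteSpace H]
    (T : H →L[ℂ] H) : ℝ≥0∞ :=
  ∑' i, ENNReal.ofReal (RCLike.re (inner ℂ (stdBasis H i) (T (stdBasis H i))))

/-- A (mixed) state: a positive trace class operator. -/
structure IsState {H : Type*} [NormedAddCommGroup H] [InnerProductSpace ℂ H] [CompleteSpace H]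
    (ρ : H →L[ℂ] H) : Prop where
  isPositive : ρ.IsPositive
  trace_ne_top : opTrace ρ ≠ ∞

lemma tsum_inner_sq {H : Type*} [NormedAddCommGroup H] [InnerProductSpace ℂ H]
    {ι : Type*} (b : HilbertBasis ι ℂ H) (x : H) :
    ∑' i, ENNReal.ofReal (‖inner ℂ (b i) x‖ ^ 2) = ENNReal.ofReal (‖x‖ ^ 2) := by
  have h2 : HasSum (fun i => ‖inner ℂ (b i) x‖ ^ 2) (‖x‖ ^ 2) := by
    have h3 := Complex.hasSum_re (b.hasSum_inner_mul_inner x x)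
    convert h3 using 1
    · ext i
      rw [← inner_conj_symm x (b i), ← Complex.normSq_eq_conj_mul_self, Complex.ofReal_re,
        Complex.normSq_eq_norm_sq]
    · exact (inner_self_eq_norm_sq (𝕜 := ℂ) x).symm
  rw [← h2.tsum_eq, ENNReal.ofReal_tsum_of_nonneg (fun i => by positivity) h2.summable]

/-- The positive square root `P^{1/2}` of a positive operator. -/
def opSqrt {H : Type*} [NormedAddCommGroup H] [InnerProductSpace ℂ H] [CompleteSpace H]
    (P : H →L[ℂ] H) : H →L[ℂ] H :=
  CFC.sqrt P

lemma sqrt_isPositive {H : Type*} [NormedAddCommGroup H] [InnerProductSpace ℂ H] [CompleteSpace H]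
    (P : H →L[ℂ] H) : (opSqrt P).IsPositive :=
  (ContinuousLinearMap.nonneg_iff_isPositive _).1 (CFC.sqrt_nonneg P)

lemma re_inner_eq_norm_sqrt_sq {H : Type*} [NormedAddCommGroup H] [InnerProductSpace ℂ H]
    [CompleteSpace H] {P : H →L[ℂ] H} (hP : P.IsPositive) (x : H) :
    RCLike.re (inner ℂ x (P x)) = ‖opSqrt P x‖ ^ 2 := by
  have h0 : 0 ≤ P := (ContinuousLinearMap.nonneg_iff_isPositive P).2 hP
  conv_lhs => rw [← CFC.sqrt_mul_sqrt_self P h0]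
  change RCLike.re (inner ℂ x (opSqrt P (opSqrt P x))) = _
  rw [← (sqrt_isPositive P).inner_left_eq_inner_right]
  exact inner_self_eq_norm_sq _

/-- The trace of a positive operator may be computed in any Hilbert basis. -/
theorem opTrace_eq_tsum {H : Type*} [NormedAddCommGroup H] [InnerProductSpace ℂ H]
    [CompleteSpace H] {P : H →L[ℂ] H} (hP : P.IsPositive)
    {ι : Type*} (b : HilbertBasis ι ℂ H) :
    opTrace P = ∑' i, ENNReal.ofReal (RCLike.re (inner ℂ (b i) (P (b i)))) := by
  unfold opTrace
  simp_rw [re_inner_eq_norm_sqrt_sq hP]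
  have h1 : ∀ i, ENNReal.ofReal (‖opSqrt P (stdBasis H i)‖ ^ 2)
      = ∑' j, ENNReal.ofReal (‖inner ℂ (b j) (opSqrt P (stdBasis H i))‖ ^ 2) :=
    fun i => (tsum_inner_sq b _).symm
  have h2 : ∀ j, ENNReal.ofReal (‖opSqrt P (b j)‖ ^ 2)
      = ∑' i, ENNReal.ofReal (‖inner ℂ (stdBasis H i) (opSqrt P (b j))‖ ^ 2) :=
    fun j => (tsum_inner_sq (stdBasis H) _).symm
  simp_rw [h1, h2]
  rw [ENNReal.tsum_comm]
  refine tsum_congr fun j => tsum_congr fun i => ?_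
  rw [← (sqrt_isPositive P).inner_left_eq_inner_right, norm_inner_symm]

/-! ### The density measure of a positive operator on `L²(μ)` -/

/-- Multiplication by the indicator function `χ_Ω` on `L²(μ)`. -/
def chi {X : Type*} [MeasurableSpace X] (μ : Measure X) {Ω : Set X} (hΩ : MeasurableSet Ω) :
    Lp ℂ 2 μ →L[ℂ] Lp ℂ 2 μ :=
  LinearMap.mkContinuous
    { toFun := fun f => ((Lp.memLp f).indicator hΩ).toLp (Ω.indicator f)
      map_add' := by
        intro f g
        ext1
        filter_upwards [((Lp.memLp (f + g)).indicator hΩ).coeFn_toLp,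
          ((Lp.memLp f).indicator hΩ).coeFn_toLp, ((Lp.memLp g).indicator hΩ).coeFn_toLp,
          Lp.coeFn_add f g, Lp.coeFn_add (((Lp.memLp f).indicator hΩ).toLp (Ω.indicator f))
            (((Lp.memLp g).indicator hΩ).toLp (Ω.indicator g))] with x h1 h2 h3 h4 h5
        rw [h1, h5, Pi.add_apply, h2, h3]
        by_cases hx : x ∈ Ω
        · simpa [hx] using h4
        · simp [hx]
      map_smul' := by
        intro c f
        ext1
        filter_upwards [((Lp.memLp (c • f)).indicator hΩ).coeFn_toLp,
          ((Lp.memLp f).indicator hΩ).coeFn_toLp, Lp.coeFn_smul c f,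
          Lp.coeFn_smul c (((Lp.memLp f).indicator hΩ).toLp (Ω.indicator f))] with x h1 h2 h4 h5
        rw [h1, RingHom.id_apply, h5, Pi.smul_apply, h2]
        by_cases hx : x ∈ Ω
        · simpa [hx] using h4
        · simp [hx] }
    1 (by
      intro f
      rw [one_mul]
      refine Lp.norm_le_norm_of_ae_le ?_
      filter_upwards [((Lp.memLp f).indicator hΩ).coeFn_toLp] with x h1
      change ‖(((Lp.memLp f).indicator hΩ).toLp (Ω.indicator f) : X → ℂ) x‖ ≤ _
      rw [h1]
      exact norm_indicator_le_norm_self _ _)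

lemma chi_coeFn {X : Type*} [MeasurableSpace X] (μ : Measure X) {Ω : Set X}
    (hΩ : MeasurableSet Ω) (f : Lp ℂ 2 μ) :
    (chi μ hΩ f : X → ℂ) =ᵐ[μ] Ω.indicator f :=
  ((Lp.memLp f).indicator hΩ).coeFn_toLp

lemma ofReal_re_inner_chi {X : Type*} [MeasurableSpace X] (μ : Measure X) {Ω : Set X}
    (hΩ : MeasurableSet Ω) (f : Lp ℂ 2 μ) :
    ENNReal.ofReal (RCLike.re (inner ℂ f (chi μ hΩ f))) = ∫⁻ x in Ω, ‖f x‖ₑ ^ 2 ∂μ := by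
  have h1 : inner ℂ f (chi μ hΩ f) = ((∫ x in Ω, ‖f x‖ ^ 2 ∂μ : ℝ) : ℂ) := by
    rw [L2.inner_def, ← integral_indicator hΩ, ← integral_complex_ofReal]
    refine integral_congr_ae ?_
    filter_upwards [chi_coeFn μ hΩ f] with x hx
    rw [hx]
    by_cases h : x ∈ Ω
    · simp [h]
    · simp [h]
  rw [h1]
  have h2 : Integrable (fun x => ‖f x‖ ^ 2) (μ.restrict Ω) :=
    ((memLp_two_iff_integrable_sq_norm (Lp.aestronglyMeasurable f)).1 (Lp.memLp f)).restrict
  rw [RCLike.re_eq_complex_re, Complex.ofReal_re, ofReal_integral_eq_lintegral_ofReal h2 (ae_of_all _ fun x => by positivity)]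
  refine lintegral_congr fun x => ?_
  rw [ENNReal.ofReal_pow (norm_nonneg _), ofReal_norm]

/-- The measure of a measurable set for `densityMeasure`:
`ν_P(Ω) = τ(P^{1/2} χ_Ω P^{1/2})`. -/
def densityValue {X : Type*} [MeasurableSpace X] (μ : Measure X) (P : Lp ℂ 2 μ →L[ℂ] Lp ℂ 2 μ)
    (Ω : Set X) (hΩ : MeasurableSet Ω) : ℝ≥0∞ :=
  opTrace (opSqrt P ∘L chi μ hΩ ∘L opSqrt P)

lemma densityValue_eq {X : Type*} [MeasurableSpace X] (μ : Measure X)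
    (P : Lp ℂ 2 μ →L[ℂ] Lp ℂ 2 μ) (Ω : Set X) (hΩ : MeasurableSet Ω) :
    densityValue μ P Ω hΩ
      = ∑' i, ∫⁻ x in Ω, ‖(opSqrt P (stdBasis (Lp ℂ 2 μ) i) : X → ℂ) x‖ₑ ^ 2 ∂μ := by
  refine tsum_congr fun i => ?_
  rw [← ofReal_re_inner_chi μ hΩ, (sqrt_isPositive P).inner_left_eq_inner_right]
  rfl

/-- The measure `ν_P(Ω) = τ(P^{1/2} χ_Ω P^{1/2})` on `X` attached to a positive bounded operator
`P` on `L²(X, μ)`. -/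
def densityMeasure {X : Type*} [MeasurableSpace X] (μ : Measure X)
    (P : Lp ℂ 2 μ →L[ℂ] Lp ℂ 2 μ) : Measure X :=
  Measure.ofMeasurable (densityValue μ P)
    (by rw [densityValue_eq]; simp)
    (by
      intro f hf hd
      simp_rw [densityValue_eq]
      rw [ENNReal.tsum_comm]
      exact tsum_congr fun i => lintegral_iUnion hf hd _)

/-- The density `dν_P / dμ` (finite almost everywhere when `P` is a state). -/
def density {X : Type*} [MeasurableSpace X] (μ : Measure X)
    (P : Lp ℂ 2 μ →L[ℂ] Lp ℂ 2 μ) (x : X) : ℝ :=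
  ((densityMeasure μ P).rnDeriv μ x).toReal

/-! ### Extended-real valued integrals -/

/-- The integral of the positive part of `f`. -/
def posIntegral {X : Type*} [MeasurableSpace X] (μ : Measure X) (f : X → ℝ) : ℝ≥0∞ :=
  ∫⁻ x, ENNReal.ofReal (f x) ∂μ

/-- The integral of the negative part of `f`. -/
def negIntegral {X : Type*} [MeasurableSpace X] (μ : Measure X) (f : X → ℝ) : ℝ≥0∞ :=
  ∫⁻ x, ENNReal.ofReal (-f x) ∂μ

/-- The integral of `f` with values in `[-∞, ∞]`; meaningful as soon as the integral of the
positive part or that of the negative part is finite. -/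
def extIntegral {X : Type*} [MeasurableSpace X] (μ : Measure X) (f : X → ℝ) : EReal :=
  (posIntegral μ f : EReal) - (negIntegral μ f : EReal)

/-! ### The Fourier transform on `L²(ℝⁿ)` with the Plancherel measure -/

/-- The measure `d*ξ = (2π)⁻ⁿ dξ` on `ℝⁿ`. -/
def volStar (n : ℕ) : Measure (EuclideanSpace ℝ (Fin n)) :=
  ENNReal.ofReal (((2 * Real.pi) ^ n)⁻¹) • volume

/-- Composition with a measure preserving equivalence, as a unitary map between `L²` spaces. -/
def compUnitary {X Y : Type*} [MeasurableSpace X] [MeasurableSpace Y] {μ : Measure X}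
    {ν : Measure Y} (e : X ≃ᵐ Y) (he : MeasurePreserving e μ ν) :
    Lp ℂ 2 ν ≃ₗᵢ[ℂ] Lp ℂ 2 μ :=
  LinearIsometryEquiv.ofSurjective (Lp.compMeasurePreservingₗᵢ ℂ e he) (by
    intro g
    refine ⟨Lp.compMeasurePreserving e.symm (he.symm e) g, ?_⟩
    change Lp.compMeasurePreserving e he _ = g
    ext1
    have h1 := Lp.coeFn_compMeasurePreserving (Lp.compMeasurePreserving e.symm (he.symm e) g) he
    have h2 := he.quasiMeasurePreserving.ae_eq_comp
      (Lp.coeFn_compMeasurePreserving g (he.symm e))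
    filter_upwards [h1, h2] with x h1 h2
    rw [h1, h2]
    simp)

/-- The dilation `ξ ↦ ξ / (2π)`. -/
def dilation (n : ℕ) : EuclideanSpace ℝ (Fin n) ≃ᵐ EuclideanSpace ℝ (Fin n) :=
  (Homeomorph.smulOfNeZero ((2 * Real.pi)⁻¹) (by positivity)).toMeasurableEquiv

lemma dilation_measurePreserving (n : ℕ) :
    MeasurePreserving (dilation n) (volStar n) volume := by
  refine ⟨(dilation n).measurable, ?_⟩
  have h : (dilation n : EuclideanSpace ℝ (Fin n) → _) = ((2 * Real.pi)⁻¹ • ·) := rfl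
  have hp : (0 : ℝ) < 2 * Real.pi := by positivity
  rw [volStar, Measure.map_smul, h, Measure.map_addHaar_smul volume (by positivity), smul_smul,
    ← ENNReal.ofReal_mul (by positivity), finrank_euclideanSpace_fin, inv_pow, inv_inv,
    abs_of_pos (by positivity), inv_mul_cancel₀ (by positivity), ENNReal.ofReal_one, one_smul]

/-- The unitary Fourier transform `L²(ℝⁿ, dx) → L²(ℝⁿ, d*ξ)`, the continuous extension of
`f̂(ξ) = ∫ e^{-i⟨x, ξ⟩} f(x) dx`. Mathlib's transform `𝓕 f (ξ) = ∫ e^{-2πi⟨x, ξ⟩} f(x) dx` is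
composed with the dilation `ξ ↦ ξ / (2π)`; see `fourierL2_schwartz`. -/
def fourierL2 (n : ℕ) :
    Lp ℂ 2 (volume : Measure (EuclideanSpace ℝ (Fin n))) ≃ₗᵢ[ℂ] Lp ℂ 2 (volStar n) :=
  (Lp.fourierTransformₗᵢ (EuclideanSpace ℝ (Fin n)) ℂ).trans
    (compUnitary (dilation n) (dilation_measurePreserving n))

/-- On Schwartz functions `fourierL2` is the integral `f̂(ξ) = ∫ e^{-i⟨x, ξ⟩} f(x) dx`. -/
theorem fourierL2_schwartz (n : ℕ) (f : 𝓢(EuclideanSpace ℝ (Fin n), ℂ)) :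
    (fourierL2 n (f.toLp 2) : EuclideanSpace ℝ (Fin n) → ℂ) =ᵐ[volStar n]
      fun ξ => ∫ x, Complex.exp (-Complex.I * (inner ℝ x ξ : ℝ)) * f x := by
  have h1 : fourierL2 n (f.toLp 2) = Lp.compMeasurePreserving (dilation n)
      (dilation_measurePreserving n) ((𝓕 f).toLp 2) := by
    rw [← SchwartzMap.toLp_fourier_eq]; rfl
  have hd := dilation_measurePreserving n
  rw [h1]
  filter_upwards [Lp.coeFn_compMeasurePreserving ((𝓕 f).toLp 2) hd,
    hd.quasiMeasurePreserving.ae_eq_comp ((𝓕 f).coeFn_toLp 2)] with ξ h2 h3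
  rw [h2, h3, Function.comp_apply, SchwartzMap.fourier_coe, Real.fourier_eq']
  refine integral_congr_ae (ae_of_all _ fun x => ?_)
  have h4 : dilation n ξ = (2 * Real.pi)⁻¹ • ξ := rfl
  have h5 : -2 * Real.pi * inner ℝ x (dilation n ξ) = -inner ℝ x ξ := by
    rw [h4, inner_smul_right]; field_simp
  simp only [h5, smul_eq_mul]
  congr 2
  push_cast
  ring

/-- The Fourier transform `ρ̂` of an operator `ρ`, determined by `ρ̂ (f̂) = (ρ f)^`. -/
def fourierConj (n : ℕ)
    (ρ : Lp ℂ 2 (volume : Measure (EuclideanSpace ℝ (Fin n))) →L[ℂ]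
      Lp ℂ 2 (volume : Measure (EuclideanSpace ℝ (Fin n)))) :
    Lp ℂ 2 (volStar n) →L[ℂ] Lp ℂ 2 (volStar n) :=
  ((fourierL2 n).toContinuousLinearEquiv : _ →L[ℂ] _) ∘L ρ ∘L
    ((fourierL2 n).symm.toContinuousLinearEquiv : _ →L[ℂ] _)

theorem fourierConj_apply (n : ℕ)
    (ρ : Lp ℂ 2 (volume : Measure (EuclideanSpace ℝ (Fin n))) →L[ℂ]
      Lp ℂ 2 (volume : Measure (EuclideanSpace ℝ (Fin n))))
    (f : Lp ℂ 2 (volume : Measure (EuclideanSpace ℝ (Fin n)))) :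
    fourierConj n ρ (fourierL2 n f) = fourierL2 n (ρ f) := by
  simp [fourierConj]

/-! ### The entropies -/

/-- The distribution function `F_ρ̂(y) = vol*({ξ | dν_ρ̂/d*ξ (ξ) ≥ y})`, for an operator `P = ρ̂` on
`L²(ℝⁿ, d*ξ)`. It is finite for `y > 0` when `P` is a state. -/
def distribution (n : ℕ) (P : Lp ℂ 2 (volStar n) →L[ℂ] Lp ℂ 2 (volStar n)) (y : ℝ) : ℝ :=
  (volStar n {ξ | y ≤ density (volStar n) P ξ}).toReal

/-- The integrand `ln(F_ρ̂(y)) F_ρ̂(y)` of `S_F(ρ̂)`. -/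
def freqIntegrand (n : ℕ) (P : Lp ℂ 2 (volStar n) →L[ℂ] Lp ℂ 2 (volStar n)) (y : ℝ) : ℝ :=
  Real.log (distribution n P y) * distribution n P y

/-- `S_F(ρ̂) = ∫_0^∞ ln(F_ρ̂(y)) F_ρ̂(y) dy`. -/
def freqEntropy (n : ℕ) (P : Lp ℂ 2 (volStar n) →L[ℂ] Lp ℂ 2 (volStar n)) : EReal :=
  extIntegral (volume.restrict (Ioi (0 : ℝ))) (freqIntegrand n P)

/-- The integrand `-ln(dν_ρ/dx)` of `S_x(ρ)`. -/
def spaceIntegrand (n : ℕ)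
    (ρ : Lp ℂ 2 (volume : Measure (EuclideanSpace ℝ (Fin n))) →L[ℂ]
      Lp ℂ 2 (volume : Measure (EuclideanSpace ℝ (Fin n))))
    (x : EuclideanSpace ℝ (Fin n)) : ℝ :=
  -Real.log (density volume ρ x)

/-- `S_x(ρ) = -∫ ln(dν_ρ/dx) dν_ρ(x)`. -/
def spaceEntropy (n : ℕ)
    (ρ : Lp ℂ 2 (volume : Measure (EuclideanSpace ℝ (Fin n))) →L[ℂ]
      Lp ℂ 2 (volume : Measure (EuclideanSpace ℝ (Fin n)))) : EReal :=
  extIntegral (densityMeasure volume ρ) (spaceIntegrand n ρ)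

end StateEntropy

end

/-! Write f for the density of ρ, F for the distribution function of the density of ρ̂, τ for the
trace and M for a bound on ‖ρ‖. The analytic core is `lintegral_sqrtGap_density_le`: for every s >
0, ∫ (√f - √(Ms))₊² dx ≤ ∫ (F(t) - s)₊ dt. To get it, cut frequencies with a weight 0 ≤ θ ≤ 1 of
volume at most s, placed where the frequency density is largest (`exists_bathtub`). The part of
ρ^{1/2} kept by θ has spatial density at most Ms, by Parseval and ‖ρ‖ ≤ M
(`tsum_enorm_sq_cutoff_le`). Minkowski's inequality in ℓ² then makes the density of the discarded
part at least (√f - √(Ms))₊², while Plancherel bounds its mass by ∫ (1 - θ) dν_ρ̂.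

Entropies appear on integrating this estimate against ds/s (`entropy_comparison`). Since both sides
tend to τ as s → 0, the integral over (0, 1] uses the deficits from τ instead. For M = 1, the
integral over (1, ∞) minus that of the deficit over (0, 1] is ∫ F ln F - τ on the right and ∫ f ln f
- 3τ on the left; 3 - 1 is the constant 2. For general M, replacing f by f/M and dx by M dx produces
τ ln M (`scaled_entropy_comparison`). Positive and negative parts are carried as separate lower
integrals, so that infinite values need no subtraction. -/

noncomputable section

namespace StateEntropy

/-! ### Logarithmic integrals -/

/-- The fundamental theorem of calculus for the lower integral of a nonnegative derivative. -/
lemma lintegral_Ioc_of_hasDerivAt {G g : ℝ → ℝ} {a b : ℝ} (hab : a ≤ b)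
    (hG : ContinuousOn G (Icc a b)) (hd : ∀ s ∈ Ioo a b, HasDerivAt G (g s) s)
    (hg : ∀ s ∈ Ioo a b, 0 ≤ g s) :
    ∫⁻ s in Ioc a b, ENNReal.ofReal (g s) = ENNReal.ofReal (G b - G a) := by
  have hi : IntegrableOn g (Ioc a b) := intervalIntegral.integrableOn_deriv_of_nonneg hG hd hg
  have h1 := intervalIntegral.integral_eq_sub_of_hasDerivAt_of_le hab hG hd
    ((intervalIntegrable_iff_integrableOn_Ioc_of_le hab).2 hi)
  rw [← h1, intervalIntegral.integral_of_le hab, integral_Ioc_eq_integral_Ioo,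
    ← restrict_Ioo_eq_restrict_Ioc,
    ofReal_integral_eq_lintegral_ofReal (hi.mono_set Ioo_subset_Ioc_self)]
  filter_upwards [ae_restrict_mem measurableSet_Ioo] with s hs using hg s hs

/-- The truncated square `(√a - √s)₊²`. -/
def sqrtGap (a s : ℝ) : ℝ := max (√a - √s) 0 ^ 2

lemma sqrtGap_nonneg (a s : ℝ) : 0 ≤ sqrtGap a s := sq_nonneg _

lemma sqrtGap_of_le {a s : ℝ} (h : a ≤ s) : sqrtGap a s = 0 := by
  simp [sqrtGap, Real.sqrt_le_sqrt h]

lemma sqrtGap_of_ge {a s : ℝ} (hs : 0 ≤ s) (h : s ≤ a) :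
    sqrtGap a s = a - 2 * (√a * √s) + s := by
  have h1 := Real.sqrt_le_sqrt h
  rw [sqrtGap, max_eq_left (by linarith), sub_sq, Real.sq_sqrt (hs.trans h), Real.sq_sqrt hs]
  ring

lemma sqrtGap_le {a s : ℝ} (ha : 0 ≤ a) : sqrtGap a s ≤ a := by
  have h1 : max (√a - √s) 0 ≤ √a := max_le (by linarith [Real.sqrt_nonneg s]) (Real.sqrt_nonneg a)
  calc sqrtGap a s ≤ √a ^ 2 := pow_le_pow_left₀ (le_max_right _ _) h1 2
    _ = a := Real.sq_sqrt ha

lemma measurable_sqrtGap : Measurable fun p : ℝ × ℝ => sqrtGap p.1 p.2 := by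
  unfold sqrtGap
  fun_prop

/-- Together with `lintegral_Ioi_inv_mul_sub` this encodes ∫_1^∞ (a - s)₊ ds/s - ∫_0^1 min(a, s)
ds/s = a ln a - a. Each integral sees one sign of a ln a, and the corrections min(a, 1) and (a - 1)₊
add up to a. -/
lemma lintegral_Ioc_inv_mul_min {a : ℝ} (ha : 0 ≤ a) :
    ∫⁻ s in Ioc 0 1, ENNReal.ofReal (s⁻¹ * min a s)
      = ENNReal.ofReal (-(a * Real.log a)) + ENNReal.ofReal (min a 1) := by
  have h1 : ∀ c : ℝ, c ≤ a → ∫⁻ s in Ioc 0 c, ENNReal.ofReal (s⁻¹ * min a s)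
      = ENNReal.ofReal c := by
    intro c hc
    rw [setLIntegral_congr_fun (g := fun _ => 1) measurableSet_Ioc]
    · simp
    · intro s hs
      simp only
      rw [min_eq_right (hs.2.trans hc), inv_mul_cancel₀ hs.1.ne', ENNReal.ofReal_one]
  rcases le_or_gt 1 a with h | h
  · rw [h1 1 h, min_eq_right h,
      ENNReal.ofReal_of_nonpos (neg_nonpos.2 (mul_nonneg ha (Real.log_nonneg h))), zero_add]
  rcases ha.eq_or_lt with rfl | ha'
  · rw [setLIntegral_congr_fun (g := fun _ => 0) measurableSet_Ioc]
    · simp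
    · intro s hs
      simp [min_eq_left hs.1.le]
  rw [← Ioc_union_Ioc_eq_Ioc ha h.le,
    lintegral_union measurableSet_Ioc (Ioc_disjoint_Ioc_of_le le_rfl), h1 a le_rfl, add_comm,
    min_eq_left h.le]
  congr 1
  rw [setLIntegral_congr_fun (g := fun s => ENNReal.ofReal (s⁻¹ * a)) measurableSet_Ioc]
  · rw [lintegral_Ioc_of_hasDerivAt (G := fun s => Real.log s * a) h.le]
    · simp [mul_comm]
    · exact (Real.continuousOn_log.mono fun s hs => (ha'.trans_le hs.1).ne').mul_const _
    · intro s hs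
      exact (Real.hasDerivAt_log (ha'.trans hs.1).ne').mul_const _
    · intro s hs
      have := ha'.trans hs.1
      positivity
  · intro s hs
    simp only
    rw [min_eq_left hs.1.le]

lemma lintegral_Ioi_eq_Ioc {a : ℝ} (ha : 1 ≤ a) {k : ℝ → ℝ≥0∞} (hk : ∀ s, a < s → k s = 0) :
    ∫⁻ s in Ioi 1, k s = ∫⁻ s in Ioc 1 a, k s := by
  rw [← Ioc_union_Ioi_eq_Ioi ha, lintegral_union measurableSet_Ioi
    (Set.disjoint_left.2 fun s h1 h2 => (not_lt.2 h1.2) h2),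
    setLIntegral_congr_fun (g := fun _ => 0) measurableSet_Ioi fun s hs => hk s hs]
  simp

lemma lintegral_Ioi_inv_mul_sub {a : ℝ} (ha : 0 ≤ a) :
    (∫⁻ s in Ioi 1, ENNReal.ofReal (s⁻¹ * (a - s))) + ENNReal.ofReal (a - 1)
      = ENNReal.ofReal (a * Real.log a) := by
  rcases le_or_gt a 1 with h | h
  · rw [setLIntegral_congr_fun (g := fun _ => 0) measurableSet_Ioi,
      ENNReal.ofReal_of_nonpos (by linarith : a - 1 ≤ 0),
      ENNReal.ofReal_of_nonpos (mul_nonpos_of_nonneg_of_nonpos ha (Real.log_nonpos ha h))]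
    · simp
    · intro s hs
      have hs' : (1 : ℝ) < s := hs
      exact ENNReal.ofReal_of_nonpos
        (mul_nonpos_of_nonneg_of_nonpos (by positivity) (by linarith))
  · rw [lintegral_Ioi_eq_Ioc h.le, lintegral_Ioc_of_hasDerivAt (G := fun s => Real.log s * a - s) h.le,
      ← ENNReal.ofReal_add]
    · congr 1
      simp
      ring
    · have h2 := Real.one_sub_inv_le_log_of_pos (zero_lt_one.trans h)
      have h3 := mul_le_mul_of_nonneg_right h2 ha
      rw [sub_mul, inv_mul_cancel₀ (by linarith)] at h3
      simp
      linarith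
    · linarith
    · exact ((Real.continuousOn_log.mono fun s hs => by
        have := hs.1; simp; linarith).mul_const _).sub continuousOn_id
    · intro s hs
      have h0 : s ≠ 0 := by linarith [hs.1]
      refine (((Real.hasDerivAt_log h0).mul_const a).sub (hasDerivAt_id s)).congr_deriv ?_
      field_simp
    · intro s hs
      have := hs.1
      exact mul_nonneg (by positivity) (by linarith [hs.2])
    · intro s hs
      exact ENNReal.ofReal_of_nonpos
        (mul_nonpos_of_nonneg_of_nonpos (by have := h.trans hs; positivity) (by linarith))

lemma hasDerivAt_four_sqrt_mul (a : ℝ) {s : ℝ} (hs : 0 < s) :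
    HasDerivAt (fun s => 4 * (√a * √s)) (s⁻¹ * (2 * (√a * √s))) s := by
  refine (((Real.hasDerivAt_sqrt hs.ne').const_mul (√a)).const_mul 4).congr_deriv ?_
  have h1 : √s ≠ 0 := (Real.sqrt_pos.2 hs).ne'
  have h2 : s⁻¹ = (√s * √s)⁻¹ := by rw [Real.mul_self_sqrt hs.le]
  rw [h2]
  field_simp
  ring

/-- The correction in the logarithmic integrals of `sqrtGap`. -/
def gapCorrection (a : ℝ) : ℝ := if a ≤ 1 then 3 * a else 4 * √a - 1

lemma gapCorrection_nonneg {a : ℝ} (ha : 0 ≤ a) : 0 ≤ gapCorrection a := by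
  unfold gapCorrection
  split_ifs with h
  · linarith
  · have := Real.one_le_sqrt.2 (not_le.1 h).le
    linarith

lemma gapCorrection_le {a : ℝ} (ha : 0 ≤ a) : gapCorrection a ≤ 3 * a := by
  unfold gapCorrection
  split_ifs with h
  · exact le_rfl
  · have h1 := Real.one_le_sqrt.2 (not_le.1 h).le
    -- The difference 3a - 4√a + 1 factors as (√a - 1)(3√a - 1).
    nlinarith [Real.sq_sqrt ha]

lemma measurable_gapCorrection : Measurable gapCorrection :=
  Measurable.ite measurableSet_Iic (by fun_prop) (by fun_prop)

/-- The analogue for the truncated square: with `lintegral_Ioi_inv_mul_sqrtGap`, the difference of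
the two integrals is a ln a - 3a. For s ≤ a the integrand is 2√a/√s - 1, with primitive 4√(as) - s;
for s ≥ a it is a/s. -/
lemma lintegral_Ioc_inv_mul_sub_sqrtGap {a : ℝ} (ha : 0 ≤ a) :
    ∫⁻ s in Ioc 0 1, ENNReal.ofReal (s⁻¹ * (a - sqrtGap a s))
      = ENNReal.ofReal (-(a * Real.log a)) + ENNReal.ofReal (gapCorrection a) := by
  have h1 : ∀ c : ℝ, 0 ≤ c → c ≤ a → ∫⁻ s in Ioc 0 c, ENNReal.ofReal (s⁻¹ * (a - sqrtGap a s))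
      = ENNReal.ofReal (4 * (√a * √c) - c) := by
    intro c hc0 hc
    rw [lintegral_Ioc_of_hasDerivAt (G := fun s => 4 * (√a * √s) - s) hc0]
    · simp
    · fun_prop
    · intro s hs
      refine ((hasDerivAt_four_sqrt_mul a hs.1).sub (hasDerivAt_id s)).congr_deriv ?_
      rw [sqrtGap_of_ge hs.1.le (hs.2.le.trans hc)]
      have := hs.1.ne'
      field_simp
      ring
    · intro s hs
      have := hs.1
      exact mul_nonneg (by positivity) (sub_nonneg.2 (sqrtGap_le ha))
  rcases ha.eq_or_lt with rfl | ha'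
  · rw [setLIntegral_congr_fun (g := fun _ => 0) measurableSet_Ioc]
    · simp [gapCorrection]
    · intro s hs
      simp [sqrtGap_of_le hs.1.le]
  rcases le_or_gt a 1 with h | h
  · rw [← Ioc_union_Ioc_eq_Ioc ha h,
      lintegral_union measurableSet_Ioc (Ioc_disjoint_Ioc_of_le le_rfl), h1 a ha le_rfl, add_comm,
      Real.mul_self_sqrt ha, gapCorrection, if_pos h]
    congr 1
    · rw [setLIntegral_congr_fun (g := fun s => ENNReal.ofReal (s⁻¹ * a)) measurableSet_Ioc]
      · rw [lintegral_Ioc_of_hasDerivAt (G := fun s => Real.log s * a) h]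
        · simp [mul_comm]
        · exact (Real.continuousOn_log.mono fun s hs => (ha'.trans_le hs.1).ne').mul_const _
        · intro s hs
          exact (Real.hasDerivAt_log (ha'.trans hs.1).ne').mul_const _
        · intro s hs
          have := ha'.trans hs.1
          positivity
      · intro s hs
        simp only
        rw [sqrtGap_of_le hs.1.le, sub_zero]
    · congr 1
      ring
  · rw [h1 1 zero_le_one h.le, gapCorrection, if_neg h.not_ge,
      ENNReal.ofReal_of_nonpos (neg_nonpos.2 (mul_nonneg ha (Real.log_nonneg h.le))), zero_add]
    simp

lemma lintegral_Ioi_inv_mul_sqrtGap {a : ℝ} (ha : 0 ≤ a) :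
    (∫⁻ s in Ioi 1, ENNReal.ofReal (s⁻¹ * sqrtGap a s)) + ENNReal.ofReal (3 * a - gapCorrection a)
      = ENNReal.ofReal (a * Real.log a) := by
  rcases le_or_gt a 1 with h | h
  · rw [setLIntegral_congr_fun (g := fun _ => 0) measurableSet_Ioi, gapCorrection, if_pos h,
      ENNReal.ofReal_of_nonpos (mul_nonpos_of_nonneg_of_nonpos ha (Real.log_nonpos ha h))]
    · simp
    · intro s hs
      simp [sqrtGap_of_le (h.trans (le_of_lt hs))]
  · have hG : ContinuousOn (fun s => Real.log s * a - 4 * (√a * √s) + s) (Icc 1 a) := by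
      refine ContinuousOn.add (ContinuousOn.sub
        ((Real.continuousOn_log.mono fun s hs => ?_).mul_const _) (by fun_prop)) continuousOn_id
      have := hs.1; simp; linarith
    have hd : ∀ s ∈ Ioo 1 a, HasDerivAt (fun s => Real.log s * a - 4 * (√a * √s) + s)
        (s⁻¹ * sqrtGap a s) s := by
      intro s hs
      have h0 : 0 < s := by linarith [hs.1]
      refine ((((Real.hasDerivAt_log h0.ne').mul_const a).sub
        (hasDerivAt_four_sqrt_mul a h0)).add (hasDerivAt_id s)).congr_deriv ?_
      rw [sqrtGap_of_ge h0.le hs.2.le]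
      field_simp
    have hn : ∀ s ∈ Ioo 1 a, 0 ≤ s⁻¹ * sqrtGap a s := fun s hs =>
      mul_nonneg (by have := hs.1; positivity) (sqrtGap_nonneg _ _)
    have hm : MonotoneOn (fun s => Real.log s * a - 4 * (√a * √s) + s) (Icc 1 a) := by
      refine monotoneOn_of_deriv_nonneg (convex_Icc _ _) hG ?_ ?_
      · rw [interior_Icc]
        exact fun s hs => (hd s hs).differentiableAt.differentiableWithinAt
      · rw [interior_Icc]
        intro s hs
        rw [(hd s hs).deriv]
        exact hn s hs
    rw [lintegral_Ioi_eq_Ioc h.le, lintegral_Ioc_of_hasDerivAt h.le hG hd hn, ← ENNReal.ofReal_add]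
    · congr 1
      simp [gapCorrection, if_neg h.not_ge, Real.mul_self_sqrt ha]
      ring
    · exact sub_nonneg.2 (hm ⟨le_rfl, h.le⟩ ⟨h.le, le_rfl⟩ h.le)
    · exact sub_nonneg.2 (gapCorrection_le ha)
    · intro s hs
      simp [sqrtGap_of_le (le_of_lt hs)]

/-! ### From a truncated comparison to a comparison of entropies -/

lemma setLIntegral_inv_mul_lintegral_swap {X : Type*} [MeasurableSpace X] {μ : Measure X}
    [SFinite μ] {S : Set ℝ} (hS : MeasurableSet S) (hS0 : S ⊆ Ioi 0) {k : X → ℝ → ℝ}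
    (hk : Measurable (Function.uncurry k)) :
    ∫⁻ s in S, ENNReal.ofReal s⁻¹ * ∫⁻ x, ENNReal.ofReal (k x s) ∂μ
      = ∫⁻ x, (∫⁻ s in S, ENNReal.ofReal (s⁻¹ * k x s)) ∂μ := by
  rw [lintegral_lintegral_swap]
  · refine setLIntegral_congr_fun hS fun s hs => ?_
    have hs' : 0 < s := hS0 hs
    have hm : Measurable fun x => ENNReal.ofReal (k x s) :=
      (hk.comp (measurable_id.prodMk measurable_const)).ennreal_ofReal
    simp_rw [ENNReal.ofReal_mul (inv_nonneg.2 hs'.le)]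
    rw [lintegral_const_mul _ hm]
  · refine Measurable.aemeasurable ?_
    exact (measurable_snd.inv.mul hk).ennreal_ofReal

/-- Integrates `key` against ds/s. The first conclusion uses only s > 1 and bounds the positive part
without any finiteness of the negative ones; the second is ∫ u ln u - 3τ ≤ ∫ F ln F - τ with the
terms moved so that it makes sense in [0, ∞]. -/
theorem entropy_comparison {X Y : Type*} [MeasurableSpace X] [MeasurableSpace Y]
    {μ : Measure X} {ν : Measure Y} [SFinite μ] [SFinite ν] {u : X → ℝ} {F : Y → ℝ} {τ : ℝ≥0∞}
    (hu : Measurable u) (hF : Measurable F) (hu0 : ∀ x, 0 ≤ u x) (hF0 : ∀ y, 0 ≤ F y)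
    (hτ : τ ≠ ∞) (huτ : ∫⁻ x, ENNReal.ofReal (u x) ∂μ = τ)
    (hFτ : ∫⁻ y, ENNReal.ofReal (F y) ∂ν = τ)
    (key : ∀ s, 0 < s → ∫⁻ x, ENNReal.ofReal (sqrtGap (u x) s) ∂μ
      ≤ ∫⁻ y, ENNReal.ofReal (F y - s) ∂ν) :
    ∫⁻ x, ENNReal.ofReal (u x * Real.log (u x)) ∂μ
        ≤ ∫⁻ y, ENNReal.ofReal (F y * Real.log (F y)) ∂ν + 3 * τ ∧
      ∫⁻ y, ENNReal.ofReal (-(F y * Real.log (F y))) ∂ν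
          + ∫⁻ x, ENNReal.ofReal (u x * Real.log (u x)) ∂μ + τ
        ≤ ∫⁻ x, ENNReal.ofReal (-(u x * Real.log (u x))) ∂μ
          + ∫⁻ y, ENNReal.ofReal (F y * Real.log (F y)) ∂ν + 3 * τ := by
  have hgap : ∀ s, Measurable fun x => sqrtGap (u x) s := fun s =>
    measurable_sqrtGap.comp (hu.prodMk measurable_const)
  have hgc : Measurable fun x => gapCorrection (u x) := measurable_gapCorrection.comp hu
  -- The complementary form of `key`: subtract both sides from the common mass τ, using F = min(F,
  -- s) + (F - s)₊. This form is integrable against ds/s near 0.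
  have hsum : ∀ s, 0 < s → ∫⁻ y, ENNReal.ofReal (min (F y) s) ∂ν
      ≤ ∫⁻ x, ENNReal.ofReal (u x - sqrtGap (u x) s) ∂μ := by
    intro s hs
    have h1 : ∫⁻ y, ENNReal.ofReal (min (F y) s) ∂ν + ∫⁻ y, ENNReal.ofReal (F y - s) ∂ν = τ := by
      rw [← lintegral_add_left (by fun_prop), ← hFτ]
      refine lintegral_congr fun y => ?_
      rcases le_total (F y) s with h | h
      · rw [min_eq_left h, ENNReal.ofReal_of_nonpos (sub_nonpos.2 h), add_zero]
      · rw [min_eq_right h, ← ENNReal.ofReal_add hs.le (sub_nonneg.2 h)]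
        congr 1
        ring
    have h2 : ∫⁻ x, ENNReal.ofReal (u x - sqrtGap (u x) s) ∂μ
        + ∫⁻ x, ENNReal.ofReal (sqrtGap (u x) s) ∂μ = τ := by
      rw [← lintegral_add_right _ (hgap s).ennreal_ofReal, ← huτ]
      refine lintegral_congr fun x => ?_
      rw [← ENNReal.ofReal_add (sub_nonneg.2 (sqrtGap_le (hu0 x))) (sqrtGap_nonneg _ _),
        sub_add_cancel]
    have h3 : ∫⁻ y, ENNReal.ofReal (F y - s) ∂ν ≠ ∞ := ne_top_of_le_ne_top hτ (h1 ▸ le_add_self)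
    refine (ENNReal.add_le_add_iff_right h3).1 ?_
    rw [h1, ← h2]
    gcongr
    exact key s hs
  have low : ∫⁻ y, (∫⁻ s in Ioc 0 1, ENNReal.ofReal (s⁻¹ * min (F y) s)) ∂ν
      ≤ ∫⁻ x, (∫⁻ s in Ioc 0 1, ENNReal.ofReal (s⁻¹ * (u x - sqrtGap (u x) s))) ∂μ := by
    rw [← setLIntegral_inv_mul_lintegral_swap measurableSet_Ioc (fun s hs => hs.1),
      ← setLIntegral_inv_mul_lintegral_swap measurableSet_Ioc (fun s hs => hs.1)]
    · refine setLIntegral_mono' measurableSet_Ioc fun s hs => ?_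
      gcongr
      exact hsum s hs.1
    · exact (hu.comp measurable_fst).sub
        (measurable_sqrtGap.comp ((hu.comp measurable_fst).prodMk measurable_snd))
    · exact (hF.comp measurable_fst).min measurable_snd
  have high : ∫⁻ x, (∫⁻ s in Ioi 1, ENNReal.ofReal (s⁻¹ * sqrtGap (u x) s)) ∂μ
      ≤ ∫⁻ y, (∫⁻ s in Ioi 1, ENNReal.ofReal (s⁻¹ * (F y - s))) ∂ν := by
    have h01 : Ioi (1 : ℝ) ⊆ Ioi 0 := Ioi_subset_Ioi zero_le_one
    rw [← setLIntegral_inv_mul_lintegral_swap measurableSet_Ioi h01,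
      ← setLIntegral_inv_mul_lintegral_swap measurableSet_Ioi h01]
    · refine setLIntegral_mono' measurableSet_Ioi fun s hs => ?_
      gcongr
      exact key s (h01 hs)
    · exact (hF.comp measurable_fst).sub measurable_snd
    · exact measurable_sqrtGap.comp ((hu.comp measurable_fst).prodMk measurable_snd)
  have i1 : ∫⁻ y, (∫⁻ s in Ioc 0 1, ENNReal.ofReal (s⁻¹ * min (F y) s)) ∂ν
      = ∫⁻ y, ENNReal.ofReal (-(F y * Real.log (F y))) ∂ν
        + ∫⁻ y, ENNReal.ofReal (min (F y) 1) ∂ν := by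
    rw [← lintegral_add_right _ (by fun_prop)]
    exact lintegral_congr fun y => lintegral_Ioc_inv_mul_min (hF0 y)
  have i2 : ∫⁻ y, (∫⁻ s in Ioi 1, ENNReal.ofReal (s⁻¹ * (F y - s))) ∂ν
        + ∫⁻ y, ENNReal.ofReal (F y - 1) ∂ν
      = ∫⁻ y, ENNReal.ofReal (F y * Real.log (F y)) ∂ν := by
    rw [← lintegral_add_right _ (by fun_prop)]
    exact lintegral_congr fun y => lintegral_Ioi_inv_mul_sub (hF0 y)
  have i3 : ∫⁻ x, (∫⁻ s in Ioc 0 1, ENNReal.ofReal (s⁻¹ * (u x - sqrtGap (u x) s))) ∂μ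
      = ∫⁻ x, ENNReal.ofReal (-(u x * Real.log (u x))) ∂μ
        + ∫⁻ x, ENNReal.ofReal (gapCorrection (u x)) ∂μ := by
    rw [← lintegral_add_right _ hgc.ennreal_ofReal]
    exact lintegral_congr fun x => lintegral_Ioc_inv_mul_sub_sqrtGap (hu0 x)
  have i4 : ∫⁻ x, (∫⁻ s in Ioi 1, ENNReal.ofReal (s⁻¹ * sqrtGap (u x) s)) ∂μ
        + ∫⁻ x, ENNReal.ofReal (3 * u x - gapCorrection (u x)) ∂μ
      = ∫⁻ x, ENNReal.ofReal (u x * Real.log (u x)) ∂μ := by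
    have hm : Measurable fun x => ENNReal.ofReal (3 * u x - gapCorrection (u x)) :=
      ((hu.const_mul 3).sub hgc).ennreal_ofReal
    rw [← lintegral_add_right _ hm]
    exact lintegral_congr fun x => lintegral_Ioi_inv_mul_sqrtGap (hu0 x)
  have j1 : ∫⁻ y, ENNReal.ofReal (min (F y) 1) ∂ν + ∫⁻ y, ENNReal.ofReal (F y - 1) ∂ν = τ := by
    rw [← lintegral_add_left (by fun_prop), ← hFτ]
    refine lintegral_congr fun y => ?_
    rcases le_total (F y) 1 with h | h
    · rw [min_eq_left h, ENNReal.ofReal_of_nonpos (sub_nonpos.2 h), add_zero]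
    · rw [min_eq_right h, ← ENNReal.ofReal_add zero_le_one (sub_nonneg.2 h)]
      congr 1
      ring
  have j2 : ∫⁻ x, ENNReal.ofReal (gapCorrection (u x)) ∂μ
      + ∫⁻ x, ENNReal.ofReal (3 * u x - gapCorrection (u x)) ∂μ = 3 * τ := by
    rw [← lintegral_add_left hgc.ennreal_ofReal, ← huτ, ← lintegral_const_mul _ hu.ennreal_ofReal]
    refine lintegral_congr fun x => ?_
    rw [← ENNReal.ofReal_add (gapCorrection_nonneg (hu0 x))
      (sub_nonneg.2 (gapCorrection_le (hu0 x))), add_sub_cancel,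
      ENNReal.ofReal_mul (by norm_num)]
    norm_num
  constructor
  · rw [← i4, ← i2, ← j2]
    refine add_le_add (high.trans le_self_add) le_add_self
  · rw [← i4, ← i2]
    nth_rw 1 [← j1]
    rw [← j2]
    have := add_le_add low high
    rw [i1, i3] at this
    generalize ∫⁻ y, ENNReal.ofReal (-(F y * Real.log (F y))) ∂ν = a1 at *
    generalize ∫⁻ x, (∫⁻ s in Ioi 1, ENNReal.ofReal (s⁻¹ * sqrtGap (u x) s)) ∂μ = a2 at *
    generalize ∫⁻ y, (∫⁻ s in Ioi 1, ENNReal.ofReal (s⁻¹ * (F y - s))) ∂ν = a3 at *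
    generalize ∫⁻ x, ENNReal.ofReal (-(u x * Real.log (u x))) ∂μ = a4 at *
    generalize ∫⁻ x, ENNReal.ofReal (gapCorrection (u x)) ∂μ = a5 at *
    generalize ∫⁻ x, ENNReal.ofReal (3 * u x - gapCorrection (u x)) ∂μ = a6 at *
    generalize ∫⁻ y, ENNReal.ofReal (min (F y) 1) ∂ν = a7 at *
    generalize ∫⁻ y, ENNReal.ofReal (F y - 1) ∂ν = a8 at *
    calc a1 + (a2 + a6) + (a7 + a8) = (a1 + a7 + a2) + (a6 + a8) := by ring
      _ ≤ (a4 + a5 + a3) + (a6 + a8) := by gcongr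
      _ = a4 + (a3 + a8) + (a5 + a6) := by ring

/-! ### The bathtub principle -/

/-- Markov's inequality. It makes the distribution function finite at positive levels, so that
`toReal` loses nothing there. -/
lemma measure_le_ne_top {Y : Type*} [MeasurableSpace Y] {ν : Measure Y} {g : Y → ℝ}
    (hg : Measurable g) (hgi : ∫⁻ y, ENNReal.ofReal (g y) ∂ν ≠ ∞) {t : ℝ} (ht : 0 < t) :
    ν {y | t ≤ g y} ≠ ∞ := by
  have h1 : {y | t ≤ g y} ⊆ {y | ENNReal.ofReal t ≤ ENNReal.ofReal (g y)} :=
    fun y hy => ENNReal.ofReal_le_ofReal hy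
  have h2 := meas_ge_le_lintegral_div (μ := ν) hg.ennreal_ofReal.aemeasurable
    (ε := ENNReal.ofReal t) (by simpa using ht) ENNReal.ofReal_ne_top
  exact ne_top_of_le_ne_top (ENNReal.div_ne_top hgi (by simpa using ht))
    ((measure_mono h1).trans h2)

/-- A threshold for which the superlevel sets of `g` enclose the volume `s`. -/
lemma exists_threshold {Y : Type*} [MeasurableSpace Y] {ν : Measure Y} {g : Y → ℝ}
    (hg : Measurable g) (hgi : ∫⁻ y, ENNReal.ofReal (g y) ∂ν ≠ ∞) {s : ℝ} (hs : 0 < s) :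
    ∃ t : ℝ, 0 ≤ t ∧ ν {y | t < g y} ≤ ENNReal.ofReal s ∧
      (0 < t → ENNReal.ofReal s ≤ ν {y | t ≤ g y}) := by
  set A : Set ℝ := {t | 0 ≤ t ∧ ν {y | t < g y} ≤ ENNReal.ofReal s} with hA
  have hmono : ∀ {a b : ℝ}, a ≤ b → ν {y | b < g y} ≤ ν {y | a < g y} :=
    fun h => measure_mono fun y hy => h.trans_lt hy
  have hAne : A.Nonempty := by
    set I := ∫⁻ y, ENNReal.ofReal (g y) ∂ν with hI
    -- By Markov the superlevel set has measure at most I/t ≤ s; the added 1 keeps t positive when I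
    -- = 0.
    refine ⟨I.toReal / s + 1, by positivity, ?_⟩
    have hp : 0 < I.toReal / s + 1 := by positivity
    have h2 := meas_ge_le_lintegral_div (μ := ν) hg.ennreal_ofReal.aemeasurable
      (ε := ENNReal.ofReal (I.toReal / s + 1)) (by simpa using hp) ENNReal.ofReal_ne_top
    refine (measure_mono fun y hy => ?_).trans (h2.trans ?_)
    · exact ENNReal.ofReal_le_ofReal (le_of_lt hy)
    · rw [← hI]
      nth_rw 1 [← ENNReal.ofReal_toReal hgi]
      rw [← ENNReal.ofReal_div_of_pos hp]
      refine ENNReal.ofReal_le_ofReal ?_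
      rw [div_le_iff₀ hp, mul_add, mul_div_cancel₀ _ hs.ne']
      linarith
  have hAb : BddBelow A := ⟨0, fun t ht => ht.1⟩
  refine ⟨sInf A, le_csInf hAne fun t ht => ht.1, ?_, fun ht => ?_⟩
  · have h1 : {y | sInf A < g y} = ⋃ n : ℕ, {y | sInf A + 1 / ((n : ℝ) + 1) < g y} := by
      ext y
      simp only [mem_ofPred_eq, mem_iUnion]
      constructor
      · intro h
        obtain ⟨n, hn⟩ := exists_nat_one_div_lt (sub_pos.2 h)
        exact ⟨n, by linarith⟩
      · rintro ⟨n, hn⟩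
        have : (0 : ℝ) < 1 / ((n : ℝ) + 1) := by positivity
        linarith
    have hm : Monotone fun n : ℕ => {y | sInf A + 1 / ((n : ℝ) + 1) < g y} := by
      intro a b hab y hy
      have hy' : sInf A + 1 / ((a : ℝ) + 1) < g y := hy
      have := one_div_le_one_div_of_le (by positivity : (0 : ℝ) < (a : ℝ) + 1)
        (by have : (a : ℝ) ≤ b := by exact_mod_cast hab
            linarith : (a : ℝ) + 1 ≤ (b : ℝ) + 1)
      exact lt_of_le_of_lt (by linarith) hy'
    rw [h1, hm.measure_iUnion]
    refine iSup_le fun n => ?_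
    obtain ⟨t, ht, htn⟩ := exists_lt_of_csInf_lt hAne
      (show sInf A < sInf A + 1 / ((n : ℝ) + 1) by
        have : (0 : ℝ) < 1 / ((n : ℝ) + 1) := by positivity
        linarith)
    exact (hmono htn.le).trans ht.2
  · set T := sInf A with hT
    -- Continuity from above along levels increasing to T. Dividing by n + 2 keeps even the first
    -- level positive, hence its superlevel set of finite measure. Levels below T are not in `A`, so
    -- their superlevel sets have measure greater than s.
    have h1 : {y | T ≤ g y} = ⋂ n : ℕ, {y | T - T / ((n : ℝ) + 2) ≤ g y} := by
      ext y
      simp only [mem_ofPred_eq, mem_iInter]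
      constructor
      · intro h n
        have : 0 < T / ((n : ℝ) + 2) := by positivity
        linarith
      · intro h
        by_contra! hlt
        obtain ⟨n, hn⟩ := exists_nat_one_div_lt (div_pos (sub_pos.2 hlt) ht)
        have h2 := h n
        have h3 : 1 / ((n : ℝ) + 2) < (T - g y) / T :=
          lt_of_le_of_lt (one_div_le_one_div_of_le (by positivity) (by linarith)) hn
        rw [lt_div_iff₀ ht, one_div_mul_eq_div] at h3
        linarith
    have hpos : ∀ n : ℕ, 0 < T - T / ((n : ℝ) + 2) := by
      intro n
      have : T / ((n : ℝ) + 2) < T := by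
        rw [div_lt_iff₀ (by positivity)]
        nlinarith [(Nat.cast_nonneg n : (0 : ℝ) ≤ n)]
      linarith
    have hm : Antitone fun n : ℕ => {y | T - T / ((n : ℝ) + 2) ≤ g y} := by
      intro a b hab y hy
      have hy' : T - T / ((b : ℝ) + 2) ≤ g y := hy
      have hab' : (a : ℝ) ≤ b := by exact_mod_cast hab
      have : T / ((b : ℝ) + 2) ≤ T / ((a : ℝ) + 2) :=
        div_le_div_of_nonneg_left ht.le (by positivity) (by linarith)
      exact le_trans (by linarith) hy'
    rw [h1, hm.measure_iInter (fun n => (measurableSet_le measurable_const hg).nullMeasurableSet)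
      ⟨0, measure_le_ne_top hg hgi (hpos 0)⟩]
    refine le_iInf fun n => ?_
    have h2 : T - T / ((n : ℝ) + 2) ∉ A := fun hmem => by
      have := csInf_le hAb hmem
      have : 0 < T / ((n : ℝ) + 2) := by positivity
      linarith
    have h3 : ENNReal.ofReal s < ν {y | T - T / ((n : ℝ) + 2) < g y} := by
      by_contra! h
      exact h2 ⟨(hpos n).le, h⟩
    exact h3.le.trans (measure_mono fun y hy => le_of_lt (Set.mem_ofPred_eq ▸ hy))

/-- The weight is 1 above a threshold t, 0 below it and a constant c on {g = t}, with c tuned to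
fill the volume s exactly when t > 0. Then (1 - θ)g + tθ = min(g, t), and the layer cake formula
turns the integral of the right side into ∫_0^t F. No atomlessness is needed, since θ may be
fractional. -/
theorem exists_bathtub {Y : Type*} [MeasurableSpace Y] {ν : Measure Y} {g : Y → ℝ}
    (hg : Measurable g) (hg0 : ∀ y, 0 ≤ g y) (hgi : ∫⁻ y, ENNReal.ofReal (g y) ∂ν ≠ ∞)
    {s : ℝ} (hs : 0 < s) :
    ∃ θ : Y → ℝ, Measurable θ ∧ (∀ y, 0 ≤ θ y) ∧ (∀ y, θ y ≤ 1) ∧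
      ∫⁻ y, ENNReal.ofReal (θ y) ∂ν ≤ ENNReal.ofReal s ∧
      ∫⁻ y, ENNReal.ofReal ((1 - θ y) * g y) ∂ν
        ≤ ∫⁻ t in Ioi (0 : ℝ), ENNReal.ofReal ((ν {y | t ≤ g y}).toReal - s) := by
  obtain ⟨t, ht0, hlt, hle⟩ := exists_threshold hg hgi hs
  have hmlt : MeasurableSet {y | t < g y} := measurableSet_lt measurable_const hg
  have hmeq : MeasurableSet {y | g y = t} := hg (measurableSet_singleton t)
  obtain ⟨c, hc0, hc1, hc2, hc3⟩ : ∃ c : ℝ, 0 ≤ c ∧ c ≤ 1 ∧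
      ν {y | t < g y} + ENNReal.ofReal c * ν {y | g y = t} ≤ ENNReal.ofReal s ∧
      (0 < t → ν {y | t < g y} + ENNReal.ofReal c * ν {y | g y = t} = ENNReal.ofReal s) := by
    rcases ht0.eq_or_lt with h | h
    -- At t = 0 the volume s need not be filled: θ = 1 wherever g > 0, so nothing is left outside.
    · refine ⟨0, le_rfl, zero_le_one, by simpa using hlt, fun h' => absurd h' (by simp [← h])⟩
    · have hb : ν {y | t ≤ g y} ≠ ∞ := measure_le_ne_top hg hgi h
      have hdec : ν {y | t ≤ g y} = ν {y | t < g y} + ν {y | g y = t} := by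
        have hd : Disjoint {y | t < g y} {y | g y = t} :=
          Set.disjoint_left.2 fun y (h1 : t < g y) (h2 : g y = t) => h1.ne' h2
        rw [← measure_union hd hmeq]
        congr 1
        ext y
        simp [le_iff_lt_or_eq, eq_comm]
      rw [hdec] at hb
      have ha : ν {y | t < g y} ≠ ∞ := ne_top_of_le_ne_top hb le_self_add
      have he : ν {y | g y = t} ≠ ∞ := ne_top_of_le_ne_top hb le_add_self
      have hle := hle h
      rw [hdec] at hle
      lift ν {y | t < g y} to NNReal using ha with a
      lift ν {y | g y = t} to NNReal using he with e
      have hle' : s ≤ a + e := by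
        have := ENNReal.toReal_mono (by simp) hle
        rwa [ENNReal.toReal_ofReal hs.le, ENNReal.toReal_add (by simp) (by simp)] at this
      have hlt' : (a : ℝ) ≤ s := by
        have := ENNReal.toReal_mono (by simp) hlt
        rwa [ENNReal.toReal_ofReal hs.le] at this
      have hmain : (a : ℝ≥0∞) + ENNReal.ofReal ((s - a) / e) * e = ENNReal.ofReal s := by
        rw [← ENNReal.ofReal_coe_nnreal (p := a), ← ENNReal.ofReal_coe_nnreal (p := e),
          ← ENNReal.ofReal_mul (div_nonneg (sub_nonneg.2 hlt') e.coe_nonneg),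
          ← ENNReal.ofReal_add a.coe_nonneg
            (mul_nonneg (div_nonneg (sub_nonneg.2 hlt') e.coe_nonneg) e.coe_nonneg)]
        congr 1
        -- If the level set is null, then a = s already and the quotient defining c is 0.
        rcases eq_or_ne (e : ℝ) 0 with h0 | h0
        · rw [h0] at hle' ⊢
          simp
          linarith
        · field_simp
          ring
      refine ⟨(s - a) / e, div_nonneg (sub_nonneg.2 hlt') e.coe_nonneg,
        div_le_one_of_le₀ (by linarith) e.coe_nonneg, hmain.le, fun _ => hmain⟩
  set θ : Y → ℝ := fun y => {y | t < g y}.indicator (fun _ => 1) y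
    + {y | g y = t}.indicator (fun _ => c) y with hθ
  have hθ_lt : ∀ y, t < g y → θ y = 1 := fun y hy => by
    simp [hθ, hy, hy.ne']
  have hθ_eq : ∀ y, g y = t → θ y = c := fun y hy => by simp [hθ, hy]
  have hθ_gt : ∀ y, g y < t → θ y = 0 := fun y hy => by simp [hθ, hy.le, hy.ne]
  have hθ0 : ∀ y, 0 ≤ θ y := fun y => by
    rcases lt_trichotomy t (g y) with h | h | h
    · simp [hθ_lt y h]
    · simpa [hθ_eq y h.symm]
    · simp [hθ_gt y h]
  have hθ1 : ∀ y, θ y ≤ 1 := fun y => by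
    rcases lt_trichotomy t (g y) with h | h | h
    · simp [hθ_lt y h]
    · simpa [hθ_eq y h.symm]
    · simp [hθ_gt y h]
  have hθm : Measurable θ :=
    (measurable_const.indicator hmlt).add (measurable_const.indicator hmeq)
  have hint : ∫⁻ y, ENNReal.ofReal (θ y) ∂ν
      = ν {y | t < g y} + ENNReal.ofReal c * ν {y | g y = t} := by
    have : ∀ y, ENNReal.ofReal (θ y) = {y | t < g y}.indicator (fun _ => 1) y
        + {y | g y = t}.indicator (fun _ => ENNReal.ofReal c) y := by
      intro y
      rcases lt_trichotomy t (g y) with h | h | h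
      · simp [hθ_lt y h, h, h.ne']
      · simp [hθ_eq y h.symm, h.symm]
      · simp [hθ_gt y h, h.le, h.ne]
    simp_rw [this]
    rw [lintegral_add_left (measurable_const.indicator hmlt), lintegral_indicator_const hmlt,
      lintegral_indicator_const hmeq, one_mul]
  refine ⟨θ, hθm, hθ0, hθ1, hint ▸ hc2, ?_⟩
  have hmin : ∫⁻ y, ENNReal.ofReal ((1 - θ y) * g y) ∂ν + ENNReal.ofReal t * ENNReal.ofReal s
      = ∫⁻ y, ENNReal.ofReal (min (g y) t) ∂ν := by
    have h1 : ENNReal.ofReal t * ENNReal.ofReal s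
        = ∫⁻ y, ENNReal.ofReal t * ENNReal.ofReal (θ y) ∂ν := by
      rw [lintegral_const_mul _ hθm.ennreal_ofReal]
      rcases ht0.eq_or_lt with h | h
      · simp [← h]
      · rw [hint, hc3 h]
    rw [h1, ← lintegral_add_left (by fun_prop)]
    refine lintegral_congr fun y => ?_
    rw [← ENNReal.ofReal_mul ht0, ← ENNReal.ofReal_add
      (mul_nonneg (sub_nonneg.2 (hθ1 y)) (hg0 y)) (mul_nonneg ht0 (hθ0 y))]
    congr 1
    rcases lt_trichotomy t (g y) with h | h | h
    · simp [hθ_lt y h, h.le]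
    · rw [← h, min_self]
      ring
    · simp [hθ_gt y h, h.le]
  have hcake : ∫⁻ y, ENNReal.ofReal (min (g y) t) ∂ν
      = ∫⁻ r in Ioc 0 t, ν {y | r ≤ g y} := by
    rw [lintegral_eq_lintegral_meas_le ν (ae_of_all _ fun y => le_min (hg0 y) ht0)
      (hg.min measurable_const).aemeasurable, ← Ioc_union_Ioi_eq_Ioi ht0,
      lintegral_union measurableSet_Ioi
        (Set.disjoint_left.2 fun s h1 h2 => (not_lt.2 h1.2) h2),
      setLIntegral_congr_fun (s := Ioi t) (g := fun _ => 0) measurableSet_Ioi, lintegral_zero,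
      add_zero]
    · refine setLIntegral_congr_fun measurableSet_Ioc fun r hr => ?_
      simp [hr.2]
    · intro r hr
      have : {a | r ≤ min (g a) t} = ∅ := by
        ext y
        simp only [le_inf_iff, mem_ofPred_eq, mem_empty_iff_false, iff_false, not_and, not_le]
        exact fun _ => hr
      change ν {a | r ≤ min (g a) t} = 0
      rw [this, measure_empty]
  -- Below the threshold every superlevel set has measure at least s, so F(r) - s is not truncated.
  have hsplit : ∫⁻ r in Ioc 0 t, ν {y | r ≤ g y}
      = (∫⁻ r in Ioc 0 t, ENNReal.ofReal ((ν {y | r ≤ g y}).toReal - s))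
        + ENNReal.ofReal t * ENNReal.ofReal s := by
    have h1 : ENNReal.ofReal t * ENNReal.ofReal s = ∫⁻ _ in Ioc 0 t, ENNReal.ofReal s := by
      simp [mul_comm]
    rw [h1, ← lintegral_add_right _ measurable_const]
    refine setLIntegral_congr_fun measurableSet_Ioc fun r hr => ?_
    have h2 : ENNReal.ofReal s ≤ ν {y | r ≤ g y} :=
      (hle (hr.1.trans_le hr.2)).trans (measure_mono fun y (hy : _ ≤ _) => hr.2.trans hy)
    have h3 := measure_le_ne_top hg hgi hr.1
    have h4 : s ≤ (ν {y | r ≤ g y}).toReal := (ENNReal.ofReal_le_iff_le_toReal h3).1 h2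
    rw [← ENNReal.ofReal_add (sub_nonneg.2 h4) hs.le, sub_add_cancel, ENNReal.ofReal_toReal h3]
  rw [hcake, hsplit] at hmin
  rw [(ENNReal.add_left_inj (ENNReal.mul_ne_top ENNReal.ofReal_ne_top ENNReal.ofReal_ne_top)).1
    hmin]
  exact lintegral_mono_set Ioc_subset_Ioi_self

/-! ### The density of a positive operator -/

/-- Distinct vectors are √2 apart, so balls of radius 1/2 about them are disjoint. Countability of a
basis of a separable L² lets sums over it commute with integrals and almost-everywhere statements.
-/
lemma countable_of_orthonormal {H ι : Type*} [NormedAddCommGroup H] [InnerProductSpace ℂ H]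
    [TopologicalSpace.SeparableSpace H] {v : ι → H} (hv : Orthonormal ℂ v) : Countable ι := by
  refine Pairwise.countable_of_isOpen_disjoint (s := fun i => Metric.ball (v i) (1 / 2)) ?_
    (fun i => Metric.isOpen_ball) fun i => ⟨v i, Metric.mem_ball_self (by norm_num)⟩
  intro i j hij
  refine Metric.ball_disjoint_ball ?_
  have h1 : ‖v i - v j‖ ^ 2 = 2 := by
    rw [@norm_sub_sq ℂ, hv.1 i, hv.1 j, hv.2 hij]
    norm_num
  rw [dist_eq_norm]
  nlinarith [norm_nonneg (v i - v j)]

/-- The image of a Hilbert basis under a unitary map. -/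
def mapBasis {H K ι : Type*} [NormedAddCommGroup H] [InnerProductSpace ℂ H]
    [NormedAddCommGroup K] [InnerProductSpace ℂ K] (b : HilbertBasis ι ℂ H) (U : H ≃ₗᵢ[ℂ] K) :
    HilbertBasis ι ℂ K :=
  HilbertBasis.ofRepr (U.symm.trans b.repr)

lemma mapBasis_apply {H K ι : Type*} [NormedAddCommGroup H] [InnerProductSpace ℂ H]
    [NormedAddCommGroup K] [InnerProductSpace ℂ K] (b : HilbertBasis ι ℂ H) (U : H ≃ₗᵢ[ℂ] K)
    (i : ι) : mapBasis b U i = U (b i) := by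
  classical
  rw [← HilbertBasis.repr_symm_single, ← HilbertBasis.repr_symm_single]
  rfl

section Density

variable {X : Type*} [MeasurableSpace X] {μ : Measure X} {ι : Type*}

lemma lintegral_enorm_sq (f : Lp ℂ 2 μ) :
    ∫⁻ x, ‖f x‖ₑ ^ 2 ∂μ = ENNReal.ofReal (‖f‖ ^ 2) := by
  have h := ofReal_re_inner_chi μ MeasurableSet.univ f
  have h1 : chi μ MeasurableSet.univ f = f := by
    ext1
    filter_upwards [chi_coeFn μ MeasurableSet.univ f] with x hx
    rw [hx, indicator_univ]
  rw [h1, Measure.restrict_univ] at h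
  rw [← h]
  congr 1
  exact inner_self_eq_norm_sq (𝕜 := ℂ) f

/-- The density of a positive operator `P`, computed in a Hilbert basis. -/
def sumSq (b : HilbertBasis ι ℂ (Lp ℂ 2 μ)) (P : Lp ℂ 2 μ →L[ℂ] Lp ℂ 2 μ) (x : X) : ℝ≥0∞ :=
  ∑' i, ‖(opSqrt P (b i) : X → ℂ) x‖ₑ ^ 2

/-- Freedom of basis matters: the Fourier side is later computed in the image of the basis used on
the spatial side. -/
lemma densityValue_eq_tsum (P : Lp ℂ 2 μ →L[ℂ] Lp ℂ 2 μ) (b : HilbertBasis ι ℂ (Lp ℂ 2 μ))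
    {Ω : Set X} (hΩ : MeasurableSet Ω) :
    densityValue μ P Ω hΩ = ∑' i, ∫⁻ x in Ω, ‖(opSqrt P (b i) : X → ℂ) x‖ₑ ^ 2 ∂μ := by
  have hchi : (chi μ hΩ).IsPositive := by
    refine ContinuousLinearMap.isPositive_iff_complex _ |>.2 fun f => ?_
    have h1 : inner ℂ (chi μ hΩ f) f = ((∫ x in Ω, ‖f x‖ ^ 2 ∂μ : ℝ) : ℂ) := by
      rw [L2.inner_def, ← integral_indicator hΩ, ← integral_complex_ofReal]
      refine integral_congr_ae ?_
      filter_upwards [chi_coeFn μ hΩ f] with x hx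
      rw [hx]
      by_cases h : x ∈ Ω
      · simp [h]
      · simp [h]
    rw [h1]
    refine ⟨by simp, ?_⟩
    rw [RCLike.re_eq_complex_re, Complex.ofReal_re]
    exact integral_nonneg fun x => by positivity
  have hpos : (opSqrt P ∘L chi μ hΩ ∘L opSqrt P).IsPositive := by
    have := hchi.conj_adjoint (opSqrt P)
    rwa [(sqrt_isPositive P).isSelfAdjoint.adjoint_eq] at this
  rw [densityValue, opTrace_eq_tsum hpos b]
  refine tsum_congr fun i => ?_
  rw [← ofReal_re_inner_chi μ hΩ, (sqrt_isPositive P).inner_left_eq_inner_right]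
  rfl

lemma measurable_density (P : Lp ℂ 2 μ →L[ℂ] Lp ℂ 2 μ) : Measurable (density μ P) :=
  (Measure.measurable_rnDeriv _ _).ennreal_toReal

lemma density_nonneg (P : Lp ℂ 2 μ →L[ℂ] Lp ℂ 2 μ) (x : X) : 0 ≤ density μ P x :=
  ENNReal.toReal_nonneg

instance countable_basisIndex {X : Type*} [MeasurableSpace X] {μ : Measure X}
    [IsSeparable μ] : Countable (basisIndex (Lp ℂ 2 μ)) := by
  have : Fact ((2 : ℝ≥0∞) ≠ ∞) := ⟨by simp⟩
  exact countable_of_orthonormal (stdBasis (Lp ℂ 2 μ)).orthonormal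

variable [Countable ι]

lemma aemeasurable_sumSq (b : HilbertBasis ι ℂ (Lp ℂ 2 μ)) (P : Lp ℂ 2 μ →L[ℂ] Lp ℂ 2 μ) :
    AEMeasurable (sumSq b P) μ :=
  AEMeasurable.tsum fun _ => ((Lp.aestronglyMeasurable _).enorm).pow_const 2

lemma densityMeasure_eq_withDensity (P : Lp ℂ 2 μ →L[ℂ] Lp ℂ 2 μ)
    (b : HilbertBasis ι ℂ (Lp ℂ 2 μ)) :
    densityMeasure μ P = μ.withDensity (sumSq b P) := by
  ext Ω hΩ
  rw [densityMeasure, Measure.ofMeasurable_apply _ hΩ, densityValue_eq_tsum P b hΩ,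
    withDensity_apply _ hΩ]
  exact (lintegral_tsum fun i =>
    (((Lp.aestronglyMeasurable _).enorm).pow_const 2).restrict).symm

lemma lintegral_sumSq {P : Lp ℂ 2 μ →L[ℂ] Lp ℂ 2 μ} (hP : P.IsPositive)
    (b : HilbertBasis ι ℂ (Lp ℂ 2 μ)) : ∫⁻ x, sumSq b P x ∂μ = opTrace P := by
  unfold sumSq
  rw [lintegral_tsum fun i => ((Lp.aestronglyMeasurable _).enorm).pow_const 2,
    opTrace_eq_tsum hP b]
  refine tsum_congr fun i => ?_
  rw [lintegral_enorm_sq, re_inner_eq_norm_sqrt_sq hP]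

/-- Finite trace makes the sum finite almost everywhere, so the real-valued density determines it.
-/
lemma ofReal_density_ae_eq [SigmaFinite μ] {P : Lp ℂ 2 μ →L[ℂ] Lp ℂ 2 μ} (hP : IsState P)
    (b : HilbertBasis ι ℂ (Lp ℂ 2 μ)) :
    (fun x => ENNReal.ofReal (density μ P x)) =ᵐ[μ] sumSq b P := by
  have h1 := Measure.rnDeriv_withDensity₀ μ (aemeasurable_sumSq b P)
  rw [← densityMeasure_eq_withDensity P b] at h1
  have h2 := ae_lt_top' (aemeasurable_sumSq b P)
    (by rw [lintegral_sumSq hP.isPositive b]; exact hP.trace_ne_top)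
  filter_upwards [h1, h2] with x hx1 hx2
  rw [density, hx1, ENNReal.ofReal_toReal hx2.ne]

end Density

/-! ### Unitary conjugation -/

section Conj

variable {H K : Type*} [NormedAddCommGroup H] [InnerProductSpace ℂ H]
  [NormedAddCommGroup K] [InnerProductSpace ℂ K]

/-- The conjugate `U T U⁻¹` of an operator by a unitary map. -/
def unitaryConj (U : H ≃ₗᵢ[ℂ] K) (T : H →L[ℂ] H) : K →L[ℂ] K :=
  (U.toContinuousLinearEquiv : _ →L[ℂ] _) ∘L T ∘L (U.symm.toContinuousLinearEquiv : _ →L[ℂ] _)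

lemma unitaryConj_apply (U : H ≃ₗᵢ[ℂ] K) (T : H →L[ℂ] H) (y : K) :
    unitaryConj U T y = U (T (U.symm y)) := rfl

lemma unitaryConj_isPositive (U : H ≃ₗᵢ[ℂ] K) {T : H →L[ℂ] H} (hT : T.IsPositive) :
    (unitaryConj U T).IsPositive := by
  refine ContinuousLinearMap.isPositive_iff_complex _ |>.2 fun y => ?_
  have h := (ContinuousLinearMap.isPositive_iff_complex _).1 hT (U.symm y)
  have h1 : inner ℂ (unitaryConj U T y) y = inner ℂ (T (U.symm y)) (U.symm y) := by
    rw [unitaryConj_apply, ← U.inner_map_map (T (U.symm y)), U.apply_symm_apply]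
  rwa [h1]

variable [CompleteSpace H] [CompleteSpace K]

/-- Uniqueness of the positive square root: the conjugate of ρ^{1/2} is positive and squares to the
conjugate of ρ. -/
lemma opSqrt_unitaryConj (U : H ≃ₗᵢ[ℂ] K) {T : H →L[ℂ] H} (hT : T.IsPositive) :
    opSqrt (unitaryConj U T) = unitaryConj U (opSqrt T) := by
  refine CFC.sqrt_unique ?_ ((ContinuousLinearMap.nonneg_iff_isPositive _).2
    (unitaryConj_isPositive U (sqrt_isPositive T)))
  ext y
  change unitaryConj U (opSqrt T) (unitaryConj U (opSqrt T) y) = _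
  simp only [unitaryConj_apply, U.symm_apply_apply]
  have h0 : 0 ≤ T := (ContinuousLinearMap.nonneg_iff_isPositive T).2 hT
  have := CFC.sqrt_mul_sqrt_self T h0
  exact congrArg U (DFunLike.congr_fun this (U.symm y))

lemma opTrace_unitaryConj (U : H ≃ₗᵢ[ℂ] K) {T : H →L[ℂ] H} (hT : T.IsPositive) :
    opTrace (unitaryConj U T) = opTrace T := by
  rw [opTrace_eq_tsum (unitaryConj_isPositive U hT) (mapBasis (stdBasis H) U)]
  refine tsum_congr fun i => ?_
  rw [mapBasis_apply, unitaryConj_apply, U.symm_apply_apply, U.inner_map_map]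

lemma IsState.unitaryConj (U : H ≃ₗᵢ[ℂ] K) {T : H →L[ℂ] H} (hT : IsState T) :
    IsState (unitaryConj U T) :=
  ⟨unitaryConj_isPositive U hT.isPositive, by
    rw [opTrace_unitaryConj U hT.isPositive]; exact hT.trace_ne_top⟩

end Conj

/-! ### The inverse Fourier transform of an integrable square integrable function -/

open scoped ContDiff in
/-- The inverse Fourier transform on `L²` is given by the integral on `L¹ ∩ L²`. -/
theorem fourierInv_Lp_ae_eq {V : Type*} [NormedAddCommGroup V] [InnerProductSpace ℝ V]
    [FiniteDimensional ℝ V] [MeasurableSpace V] [BorelSpace V]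
    (h : Lp ℂ 2 (volume : Measure V)) (hi : Integrable h) :
    ((𝓕⁻ h : Lp ℂ 2 (volume : Measure V)) : V → ℂ) =ᵐ[volume] 𝓕⁻ (h : V → ℂ) := by
  have hL : Continuous fun p : V × V => (-innerₗ V) p.1 p.2 := by
    simp only [LinearMap.neg_apply, innerₗ_apply_apply]
    fun_prop
  have hcont : Continuous (𝓕⁻ (h : V → ℂ)) :=
    VectorFourier.fourierIntegral_continuous Real.continuous_fourierChar
      (L := -innerₗ V) hL hi
  -- Both sides are locally integrable, so it suffices to test against smooth compactly supported g.
  -- Each pairing equals ∫ (𝓕⁻ φ) h: one by the transform of tempered distributions, the other by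
  -- the exchange formula for an integrable h.
  refine ae_eq_of_integral_contDiff_smul_eq
    ((Lp.memLp (𝓕⁻ h : Lp ℂ 2 (volume : Measure V))).locallyIntegrable (by norm_num))
    hcont.locallyIntegrable fun g hg hgc => ?_
  have h1 : HasCompactSupport (Complex.ofRealCLM ∘ g) := hgc.comp_left rfl
  have h2 : ContDiff ℝ ∞ (Complex.ofRealCLM ∘ g) := by fun_prop
  set φ : 𝓢(V, ℂ) := h1.toSchwartzMap h2 with hφ
  have hφa : ∀ x, φ x = (g x : ℂ) := fun x => rfl
  have h3 := DFunLike.congr_fun (Lp.fourierInv_toTemperedDistribution_eq h) φ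
  rw [TemperedDistribution.fourierInv_apply, Lp.toTemperedDistribution_apply,
    Lp.toTemperedDistribution_apply] at h3
  have h4 := VectorFourier.integral_fourierIntegral_smul_eq_flip (μ := volume) (ν := volume)
    (L := -innerₗ V) Real.continuous_fourierChar hL
    φ.integrable hi
  have h5 : (-innerₗ V).flip = -innerₗ V := by
    ext x y
    simp [real_inner_comm]
  rw [h5] at h4
  calc ∫ x, g x • (𝓕⁻ h : Lp ℂ 2 (volume : Measure V)) x
      = ∫ x, φ x • (𝓕⁻ h : Lp ℂ 2 (volume : Measure V)) x := by simp [hφa]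
    _ = ∫ x, (𝓕⁻ φ) x • h x := h3.symm
    _ = ∫ x, φ x • 𝓕⁻ (h : V → ℂ) x := by
      rw [SchwartzMap.fourierInv_coe]
      exact h4
    _ = ∫ x, g x • 𝓕⁻ (h : V → ℂ) x := by simp [hφa]

/-- The inverse of the unitary Fourier transform is given by an integral on `L¹ ∩ L²`. -/
theorem fourierL2_symm_ae_eq (n : ℕ) (h : Lp ℂ 2 (volStar n)) (hi : Integrable h (volStar n)) :
    ((fourierL2 n).symm h : EuclideanSpace ℝ (Fin n) → ℂ) =ᵐ[volume]
      fun x => ∫ ξ, Real.fourierChar (inner ℝ (dilation n ξ) x) • h ξ ∂(volStar n) := by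
  have hd := dilation_measurePreserving n
  set k : Lp ℂ 2 (volume : Measure (EuclideanSpace ℝ (Fin n))) :=
    (compUnitary (dilation n) hd).symm h with hk
  have hk1 : h = Lp.compMeasurePreserving (dilation n) hd k :=
    ((compUnitary (dilation n) hd).apply_symm_apply h).symm
  have hk2 : (h : EuclideanSpace ℝ (Fin n) → ℂ) =ᵐ[volStar n] k ∘ dilation n := by
    conv_lhs => rw [hk1]
    exact Lp.coeFn_compMeasurePreserving k hd
  have hki : Integrable k := by
    rw [← hd.integrable_comp_emb (dilation n).measurableEmbedding]
    exact hi.congr hk2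
  have h1 : (fourierL2 n).symm h = 𝓕⁻ k := rfl
  rw [h1]
  filter_upwards [fourierInv_Lp_ae_eq k hki] with x hx
  rw [hx, Real.fourierInv_eq, ← hd.integral_comp (dilation n).measurableEmbedding]
  refine integral_congr_ae ?_
  filter_upwards [hk2] with ξ hξ
  rw [hξ, Function.comp_apply]

/-! ### The truncated comparison of the densities of a state and its Fourier transform -/

/-- Minkowski's inequality in `ℓ²`, as a lower bound for one of the summands. -/
lemma ofReal_sqrtGap_le_tsum {ι : Type*} {a b : ι → ℂ} {r p : ℝ} (hr : 0 ≤ r)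
    (hab : ∑' i, ‖a i + b i‖ₑ ^ 2 = ENNReal.ofReal r)
    (ha : ∑' i, ‖a i‖ₑ ^ 2 ≤ ENNReal.ofReal p) :
    ENNReal.ofReal (sqrtGap r p) ≤ ∑' i, ‖b i‖ₑ ^ 2 := by
  rcases eq_or_ne (∑' i, ‖b i‖ₑ ^ 2) ∞ with hb | hb
  · simp [hb]
  let _ : MeasurableSpace ι := ⊤
  have h := ENNReal.lintegral_Lp_add_le (μ := Measure.count) (p := 2) (f := fun i => ‖a i‖ₑ)
    (g := fun i => ‖b i‖ₑ) measurable_from_top.aemeasurable measurable_from_top.aemeasurable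
    (by norm_num)
  simp only [lintegral_count, Pi.add_apply, ENNReal.rpow_two] at h
  have h1 : ENNReal.ofReal r ≤ ∑' i, (‖a i‖ₑ + ‖b i‖ₑ) ^ 2 := by
    rw [← hab]
    exact ENNReal.tsum_le_tsum fun i => pow_le_pow_left₀ zero_le (enorm_add_le _ _) 2
  have h2 : ENNReal.ofReal r ^ (1 / 2 : ℝ)
      ≤ ENNReal.ofReal p ^ (1 / 2 : ℝ) + (∑' i, ‖b i‖ₑ ^ 2) ^ (1 / 2 : ℝ) := by
    refine (ENNReal.rpow_le_rpow h1 (by norm_num)).trans (h.trans ?_)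
    gcongr
  -- The sign of p is free: `ENNReal.ofReal` and the real square root both send negative numbers to
  -- 0.
  have hp : ENNReal.ofReal p = ENNReal.ofReal (max p 0) := by
    rcases le_total p 0 with h | h
    · simp [h]
    · simp [h]
  have hsp : √p = √(max p 0) := by
    rcases le_total p 0 with h | h
    · simp [h, Real.sqrt_eq_zero_of_nonpos]
    · simp [h]
  rw [← ENNReal.ofReal_toReal hb] at h2 ⊢
  set q := (∑' i, ‖b i‖ₑ ^ 2).toReal
  have hq : 0 ≤ q := ENNReal.toReal_nonneg
  rw [hp, ENNReal.ofReal_rpow_of_nonneg hr (by norm_num),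
    ENNReal.ofReal_rpow_of_nonneg (le_max_right _ _) (by norm_num),
    ENNReal.ofReal_rpow_of_nonneg hq (by norm_num), ← Real.sqrt_eq_rpow, ← Real.sqrt_eq_rpow,
    ← Real.sqrt_eq_rpow, ← ENNReal.ofReal_add (Real.sqrt_nonneg _) (Real.sqrt_nonneg _),
    ENNReal.ofReal_le_ofReal_iff (by positivity), ← hsp] at h2
  refine ENNReal.ofReal_le_ofReal ?_
  rw [sqrtGap, ← Real.sq_sqrt hq]
  exact pow_le_pow_left₀ (le_max_right _ _)
    (max_le (by linarith) (Real.sqrt_nonneg q)) 2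

lemma norm_opSqrt_sq_le {H : Type*} [NormedAddCommGroup H] [InnerProductSpace ℂ H]
    [CompleteSpace H] {P : H →L[ℂ] H} (hP : P.IsPositive) (v : H) :
    ‖opSqrt P v‖ ^ 2 ≤ ‖P‖ * ‖v‖ ^ 2 := by
  rw [← re_inner_eq_norm_sqrt_sq hP]
  calc RCLike.re (inner ℂ v (P v)) ≤ ‖v‖ * ‖P v‖ := re_inner_le_norm _ _
    _ ≤ ‖v‖ * (‖P‖ * ‖v‖) := by gcongr; exact P.le_opNorm v
    _ = ‖P‖ * ‖v‖ ^ 2 := by ring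

instance sigmaFinite_volStar (n : ℕ) : SigmaFinite (volStar n) :=
  inferInstanceAs (SigmaFinite (Real.toNNReal (((2 * Real.pi) ^ n)⁻¹) •
    (volume : Measure (EuclideanSpace ℝ (Fin n)))))

section Cutoff

variable {n : ℕ} {θ : EuclideanSpace ℝ (Fin n) → ℝ}

lemma memLp_cutoff_mul (hθ : Measurable θ) (hθ0 : ∀ ξ, 0 ≤ θ ξ) (hθ1 : ∀ ξ, θ ξ ≤ 1)
    (c : Lp ℂ 2 (volStar n)) : MemLp (fun ξ => (θ ξ : ℂ) * c ξ) 2 (volStar n) := by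
  refine (Lp.memLp c).of_le
    ((Complex.measurable_ofReal.comp hθ).aestronglyMeasurable.mul (Lp.aestronglyMeasurable c))
    (ae_of_all _ fun ξ => ?_)
  rw [norm_mul, Complex.norm_real, Real.norm_of_nonneg (hθ0 ξ)]
  exact mul_le_of_le_one_left (norm_nonneg _) (hθ1 ξ)

lemma memLp_two_cutoff (hθ : Measurable θ) (hθ0 : ∀ ξ, 0 ≤ θ ξ) (hθ1 : ∀ ξ, θ ξ ≤ 1)
    (hi : ∫⁻ ξ, ENNReal.ofReal (θ ξ) ∂(volStar n) ≠ ∞) : MemLp θ 2 (volStar n) := by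
  rw [memLp_two_iff_integrable_sq hθ.aestronglyMeasurable]
  have h1 : Integrable θ (volStar n) := by
    refine ⟨hθ.aestronglyMeasurable, ?_⟩
    rw [hasFiniteIntegral_iff_ofReal (ae_of_all _ hθ0)]
    exact hi.lt_top
  refine h1.mono' (hθ.pow_const 2).aestronglyMeasurable (ae_of_all _ fun ξ => ?_)
  rw [Real.norm_of_nonneg (sq_nonneg _), sq]
  exact mul_le_of_le_one_left (hθ0 ξ) (hθ1 ξ)

/-- The diagonal of the kernel of a frequency cutoff of a state is bounded by the volume of the
cutoff. -/
lemma tsum_enorm_sq_cutoff_le {ρ : Lp ℂ 2 (volume : Measure (EuclideanSpace ℝ (Fin n))) →L[ℂ]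
      Lp ℂ 2 (volume : Measure (EuclideanSpace ℝ (Fin n)))} (hρ : ρ.IsPositive)
    {ι : Type*} (b : HilbertBasis ι ℂ (Lp ℂ 2 (volume : Measure (EuclideanSpace ℝ (Fin n)))))
    {M s : ℝ} (hM : ‖ρ‖ ≤ M) (hM0 : 0 ≤ M)
    (hθ : Measurable θ) (hθ0 : ∀ ξ, 0 ≤ θ ξ) (hθ1 : ∀ ξ, θ ξ ≤ 1)
    (hi : ∫⁻ ξ, ENNReal.ofReal (θ ξ) ∂(volStar n) ≤ ENNReal.ofReal s)
    (x : EuclideanSpace ℝ (Fin n)) :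
    ∑' i, ‖∫ ξ, Real.fourierChar (inner ℝ (dilation n ξ) x)
        • ((θ ξ : ℂ) * fourierL2 n (opSqrt ρ (b i)) ξ) ∂(volStar n)‖ₑ ^ 2
      ≤ ENNReal.ofReal (M * s) := by
  set e : EuclideanSpace ℝ (Fin n) → ℂ := fun ξ =>
    (Real.fourierChar (inner ℝ (dilation n ξ) x) : ℂ) with he
  have hem : Measurable e := by
    have h1 : Measurable fun ξ => inner ℝ (dilation n ξ) x :=
      (dilation n).measurable.inner measurable_const
    exact (continuous_subtype_val.comp Real.continuous_fourierChar).measurable.comp h1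
  have he1 : ∀ ξ, ‖e ξ‖ = 1 := fun ξ => Circle.norm_coe _
  have hk : MemLp (fun ξ => (starRingEnd ℂ) (e ξ) * (θ ξ : ℂ)) 2 (volStar n) := by
    refine (memLp_two_cutoff hθ hθ0 hθ1 (ne_top_of_le_ne_top ENNReal.ofReal_ne_top hi)).of_le
      ((Complex.continuous_conj.measurable.comp hem).mul
        (Complex.measurable_ofReal.comp hθ)).aestronglyMeasurable (ae_of_all _ fun ξ => ?_)
    rw [norm_mul, RCLike.norm_conj, he1, one_mul, Complex.norm_real]
  -- For fixed x the integrals are coefficients of one vector ρ^{1/2} v, where v is the inverse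
  -- transform of the conjugate character times θ. Parseval sums them to ‖ρ^{1/2} v‖² ≤ M‖v‖² = M ∫
  -- θ² ≤ M ∫ θ.
  set k : Lp ℂ 2 (volStar n) := hk.toLp _ with hkdef
  set v := (fourierL2 n).symm k with hv
  have h1 : ∀ i, ∫ ξ, Real.fourierChar (inner ℝ (dilation n ξ) x)
      • ((θ ξ : ℂ) * fourierL2 n (opSqrt ρ (b i)) ξ) ∂(volStar n)
      = inner ℂ (opSqrt ρ v) (b i) := by
    intro i
    rw [(sqrt_isPositive ρ).inner_left_eq_inner_right, hv,
      ← (fourierL2 n).inner_map_map, (fourierL2 n).apply_symm_apply, L2.inner_def]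
    refine integral_congr_ae ?_
    filter_upwards [hk.coeFn_toLp] with ξ hξ
    rw [← hkdef] at hξ
    rw [hξ, RCLike.inner_apply, map_mul, Complex.conj_conj, Complex.conj_ofReal, Circle.smul_def,
      smul_eq_mul]
    ring
  have h2 : ∀ i, ‖∫ ξ, Real.fourierChar (inner ℝ (dilation n ξ) x)
      • ((θ ξ : ℂ) * fourierL2 n (opSqrt ρ (b i)) ξ) ∂(volStar n)‖ₑ ^ 2
      = ENNReal.ofReal (‖inner ℂ (b i) (opSqrt ρ v)‖ ^ 2) := by
    intro i
    rw [h1, ENNReal.ofReal_pow (norm_nonneg _), ← norm_inner_symm, ofReal_norm]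
  simp_rw [h2]
  rw [tsum_inner_sq]
  have h3 : ENNReal.ofReal (‖v‖ ^ 2) ≤ ENNReal.ofReal s := by
    rw [hv, LinearIsometryEquiv.norm_map, ← lintegral_enorm_sq]
    refine le_trans (lintegral_mono_ae ?_) hi
    filter_upwards [hk.coeFn_toLp] with ξ hξ
    rw [← hkdef] at hξ
    rw [hξ, ← ofReal_norm, norm_mul, RCLike.norm_conj, he1, one_mul, Complex.norm_real,
      Real.norm_of_nonneg (hθ0 ξ), ← ENNReal.ofReal_pow (hθ0 ξ), sq]
    exact ENNReal.ofReal_le_ofReal (mul_le_of_le_one_left (hθ0 ξ) (hθ1 ξ))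
  calc ENNReal.ofReal (‖opSqrt ρ v‖ ^ 2) ≤ ENNReal.ofReal (M * ‖v‖ ^ 2) := by
        refine ENNReal.ofReal_le_ofReal ((norm_opSqrt_sq_le hρ v).trans ?_)
        gcongr
    _ = ENNReal.ofReal M * ENNReal.ofReal (‖v‖ ^ 2) := ENNReal.ofReal_mul hM0
    _ ≤ ENNReal.ofReal M * ENNReal.ofReal s := by gcongr
    _ = ENNReal.ofReal (M * s) := (ENNReal.ofReal_mul hM0).symm

end Cutoff

theorem fourierConj_isState {n : ℕ}
    {ρ : Lp ℂ 2 (volume : Measure (EuclideanSpace ℝ (Fin n))) →L[ℂ]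
      Lp ℂ 2 (volume : Measure (EuclideanSpace ℝ (Fin n)))} (hρ : IsState ρ) :
    IsState (fourierConj n ρ) :=
  hρ.unitaryConj (fourierL2 n)

set_option maxHeartbeats 1000000 in
-- The cutoff splits each ρ^{1/2} b_i into a low part `A i`, controlled pointwise in x by the volume
-- s, and a remainder `B i`, controlled in L² by Plancherel. Minkowski's inequality at each x links
-- the two.
theorem lintegral_sqrtGap_density_le {n : ℕ}
    {ρ : Lp ℂ 2 (volume : Measure (EuclideanSpace ℝ (Fin n))) →L[ℂ]
      Lp ℂ 2 (volume : Measure (EuclideanSpace ℝ (Fin n)))} (hρ : IsState ρ)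
    {M s : ℝ} (hM : ‖ρ‖ ≤ M) (hs : 0 < s) :
    ∫⁻ x, ENNReal.ofReal (sqrtGap (density volume ρ x) (M * s))
      ≤ ∫⁻ t in Ioi (0 : ℝ), ENNReal.ofReal (distribution n (fourierConj n ρ) t - s) := by
  have hM0 : 0 ≤ M := (norm_nonneg ρ).trans hM
  have hρ' := fourierConj_isState hρ
  set b := stdBasis (Lp ℂ 2 (volume : Measure (EuclideanSpace ℝ (Fin n))))
  have hf := ofReal_density_ae_eq hρ b
  have hg := ofReal_density_ae_eq hρ' (mapBasis b (fourierL2 n))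
  set c := fun i => fourierL2 n (opSqrt ρ (b i)) with hc
  have hgc : ∀ ξ, sumSq (mapBasis b (fourierL2 n)) (fourierConj n ρ) ξ
      = ∑' i, ‖(c i : EuclideanSpace ℝ (Fin n) → ℂ) ξ‖ₑ ^ 2 := by
    intro ξ
    have h1 : opSqrt (fourierConj n ρ) = unitaryConj (fourierL2 n) (opSqrt ρ) :=
      opSqrt_unitaryConj (fourierL2 n) hρ.isPositive
    unfold sumSq
    rw [h1]
    refine tsum_congr fun i => ?_
    rw [mapBasis_apply, unitaryConj_apply, LinearIsometryEquiv.symm_apply_apply]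
  have hgi : ∫⁻ ξ, ENNReal.ofReal (density (volStar n) (fourierConj n ρ) ξ) ∂(volStar n) ≠ ∞ := by
    rw [lintegral_congr_ae hg, lintegral_sumSq hρ'.isPositive]
    exact hρ'.trace_ne_top
  obtain ⟨θ, hθ, hθ0, hθ1, hθs, hθg⟩ :=
    exists_bathtub (measurable_density (fourierConj n ρ)) (density_nonneg _) hgi hs
  refine le_trans ?_ hθg
  have hη : Measurable fun ξ => 1 - θ ξ := measurable_const.sub hθ
  have hη0 : ∀ ξ, 0 ≤ 1 - θ ξ := fun ξ => sub_nonneg.2 (hθ1 ξ)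
  have hη1 : ∀ ξ, 1 - θ ξ ≤ 1 := fun ξ => sub_le_self _ (hθ0 ξ)
  have hA := fun i => memLp_cutoff_mul hθ hθ0 hθ1 (c i)
  have hB := fun i => memLp_cutoff_mul hη hη0 hη1 (c i)
  set A := fun i => (hA i).toLp _ with hAdef
  set B := fun i => (hB i).toLp _ with hBdef
  have hAB : ∀ i, opSqrt ρ (b i) = (fourierL2 n).symm (A i) + (fourierL2 n).symm (B i) := by
    intro i
    rw [← map_add, LinearIsometryEquiv.eq_symm_apply]
    ext1
    filter_upwards [Lp.coeFn_add (A i) (B i), (hA i).coeFn_toLp, (hB i).coeFn_toLp]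
      with ξ h1 h2 h3
    rw [h1, Pi.add_apply, h2, h3]
    simp only [hc]
    push_cast
    ring
  -- A product of two L² functions: integrability is what gives the pointwise integral formula for
  -- the inverse transform.
  have hAi : ∀ i, Integrable (A i) (volStar n) := by
    intro i
    refine Integrable.congr ?_ (hA i).coeFn_toLp.symm
    exact (memLp_two_cutoff hθ hθ0 hθ1
      (ne_top_of_le_ne_top ENNReal.ofReal_ne_top hθs)).ofReal.integrable_mul (Lp.memLp (c i))
  have hAx : ∀ᵐ x, ∀ i, ((fourierL2 n).symm (A i) : EuclideanSpace ℝ (Fin n) → ℂ) x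
      = ∫ ξ, Real.fourierChar (inner ℝ (dilation n ξ) x) • ((θ ξ : ℂ) * c i ξ) ∂(volStar n) := by
    rw [ae_all_iff]
    intro i
    filter_upwards [fourierL2_symm_ae_eq n (A i) (hAi i)] with x hx
    rw [hx]
    refine integral_congr_ae ?_
    filter_upwards [(hA i).coeFn_toLp] with ξ hξ
    rw [hξ]
  have hsum : ∀ᵐ x, ∀ i, (opSqrt ρ (b i) : EuclideanSpace ℝ (Fin n) → ℂ) x
      = (fourierL2 n).symm (A i) x + (fourierL2 n).symm (B i) x := by
    rw [ae_all_iff]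
    intro i
    filter_upwards [Lp.coeFn_add ((fourierL2 n).symm (A i)) ((fourierL2 n).symm (B i))] with x hx
    rw [hAB i, hx, Pi.add_apply]
  calc ∫⁻ x, ENNReal.ofReal (sqrtGap (density volume ρ x) (M * s))
      ≤ ∫⁻ x, ∑' i, ‖((fourierL2 n).symm (B i) : EuclideanSpace ℝ (Fin n) → ℂ) x‖ₑ ^ 2 := by
        refine lintegral_mono_ae ?_
        filter_upwards [hf, hAx, hsum] with x hfx hAx hsum
        refine ofReal_sqrtGap_le_tsum (a := fun i => (fourierL2 n).symm (A i) x)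
          (density_nonneg ρ x) ?_ ?_
        · rw [hfx]
          exact tsum_congr fun i => by rw [hsum i]
        · simp_rw [hAx]
          exact tsum_enorm_sq_cutoff_le hρ.isPositive b hM hM0 hθ hθ0 hθ1 hθs x
    _ = ∑' i, ENNReal.ofReal (‖B i‖ ^ 2) := by
        rw [lintegral_tsum fun i => ((Lp.aestronglyMeasurable _).enorm).pow_const 2]
        refine tsum_congr fun i => ?_
        rw [lintegral_enorm_sq, LinearIsometryEquiv.norm_map]
    _ = ∫⁻ ξ, ∑' i, ‖(B i : EuclideanSpace ℝ (Fin n) → ℂ) ξ‖ₑ ^ 2 ∂(volStar n) := by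
        rw [lintegral_tsum fun i => ((Lp.aestronglyMeasurable _).enorm).pow_const 2]
        exact tsum_congr fun i => (lintegral_enorm_sq _).symm
    -- Uses (1 - θ)² ≤ 1 - θ.
    _ ≤ ∫⁻ ξ, ENNReal.ofReal ((1 - θ ξ) * density (volStar n) (fourierConj n ρ) ξ)
          ∂(volStar n) := by
        refine lintegral_mono_ae ?_
        filter_upwards [hg, ae_all_iff.2 fun i => (hB i).coeFn_toLp] with ξ hgξ hBξ
        rw [ENNReal.ofReal_mul (hη0 ξ), hgξ, hgc, ← ENNReal.tsum_mul_left]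
        refine ENNReal.tsum_le_tsum fun i => ?_
        simp only [hBdef]
        rw [hBξ i, enorm_mul, mul_pow]
        gcongr
        rw [← ofReal_norm, Complex.norm_real, Real.norm_of_nonneg (hη0 ξ),
          ← ENNReal.ofReal_pow (hη0 ξ), sq]
        exact ENNReal.ofReal_le_ofReal (mul_le_of_le_one_left (hη0 ξ) (hη1 ξ))

/-! ### The entropy inequality -/

lemma measurable_distribution (n : ℕ) (P : Lp ℂ 2 (volStar n) →L[ℂ] Lp ℂ 2 (volStar n)) :
    Measurable (distribution n P) := by
  have h : Antitone fun y : ℝ => volStar n {ξ | y ≤ density (volStar n) P ξ} :=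
    fun a b hab => measure_mono fun ξ hξ => hab.trans hξ
  exact h.measurable.ennreal_toReal

lemma lintegral_density {X : Type*} [MeasurableSpace X] {μ : Measure X} [SigmaFinite μ]
    [IsSeparable μ] {P : Lp ℂ 2 μ →L[ℂ] Lp ℂ 2 μ} (hP : IsState P) :
    ∫⁻ x, ENNReal.ofReal (density μ P x) ∂μ = opTrace P := by
  rw [lintegral_congr_ae (ofReal_density_ae_eq hP (stdBasis _)), lintegral_sumSq hP.isPositive]

lemma lintegral_densityMeasure {X : Type*} [MeasurableSpace X] {μ : Measure X} [SigmaFinite μ]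
    [IsSeparable μ] {P : Lp ℂ 2 μ →L[ℂ] Lp ℂ 2 μ} (hP : IsState P) {k : X → ℝ}
    (hk : Measurable k) :
    ∫⁻ x, ENNReal.ofReal (k x) ∂(densityMeasure μ P)
      = ∫⁻ x, ENNReal.ofReal (density μ P x * k x) ∂μ := by
  rw [densityMeasure_eq_withDensity P (stdBasis _),
    ← withDensity_congr_ae (ofReal_density_ae_eq hP (stdBasis _)),
    lintegral_withDensity_eq_lintegral_mul _ (measurable_density P).ennreal_ofReal
      hk.ennreal_ofReal]
  refine lintegral_congr fun x => ?_
  rw [Pi.mul_apply, ENNReal.ofReal_mul (density_nonneg P x)]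

/-- Layer cake: F has the same total mass as the frequency density, as the comparison of entropies
requires. -/
lemma lintegral_distribution {n : ℕ} {P : Lp ℂ 2 (volStar n) →L[ℂ] Lp ℂ 2 (volStar n)}
    (hP : IsState P) :
    ∫⁻ y in Ioi (0 : ℝ), ENNReal.ofReal (distribution n P y) = opTrace P := by
  have hi := lintegral_density hP
  rw [← hi, lintegral_eq_lintegral_meas_le _ (ae_of_all _ (density_nonneg P))
    (measurable_density P).aemeasurable]
  refine setLIntegral_congr_fun measurableSet_Ioi fun y hy => ?_
  exact ENNReal.ofReal_toReal
    (measure_le_ne_top (measurable_density P) (hi ▸ hP.trace_ne_top) hy)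

lemma sqrtGap_div {a s M : ℝ} (hM : 0 < M) :
    sqrtGap (a / M) s = sqrtGap a (M * s) / M := by
  have h1 : √(a / M) - √s = (√a - √(M * s)) / √M := by
    rw [Real.sqrt_div' _ hM.le, Real.sqrt_mul hM.le]
    have := (Real.sqrt_pos.2 hM).ne'
    field_simp
  have h2 : max (√(a / M) - √s) 0 = max (√a - √(M * s)) 0 / √M := by
    rw [h1, ← max_div_div_right (Real.sqrt_nonneg M), zero_div]
  rw [sqrtGap, h2, div_pow, Real.sq_sqrt hM.le, sqrtGap]

/-- Rescaling a density by a constant shifts its entropy by a multiple of its integral. -/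
lemma mul_div_mul_log_div {a M : ℝ} (hM : 0 < M) :
    M * (a / M * Real.log (a / M)) = a * Real.log a - a * Real.log M := by
  rcases eq_or_ne a 0 with rfl | h
  · simp
  · rw [Real.log_div h hM.ne']
    field_simp

/-- The entropy comparison of a density `f` and a function `F` with the same integral `τ`,
when `f` is rescaled by `M`. -/
theorem scaled_entropy_comparison {X Y : Type*} [MeasurableSpace X] [MeasurableSpace Y]
    {μ : Measure X} {ν : Measure Y} [SFinite μ] [SFinite ν] {f : X → ℝ} {F : Y → ℝ} {τ : ℝ≥0∞}
    (hf : Measurable f) (hF : Measurable F) (hf0 : ∀ x, 0 ≤ f x) (hF0 : ∀ y, 0 ≤ F y)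
    (hτ : τ ≠ ∞) (hfτ : ∫⁻ x, ENNReal.ofReal (f x) ∂μ = τ)
    (hFτ : ∫⁻ y, ENNReal.ofReal (F y) ∂ν = τ) {M : ℝ} (hM : 0 < M)
    (key : ∀ s, 0 < s → ∫⁻ x, ENNReal.ofReal (sqrtGap (f x) (M * s)) ∂μ
      ≤ ∫⁻ y, ENNReal.ofReal (F y - s) ∂ν)
    (hA : ∫⁻ y, ENNReal.ofReal (F y * Real.log (F y)) ∂ν ≠ ∞) :
    ∫⁻ x, ENNReal.ofReal (f x * Real.log (f x)) ∂μ ≠ ∞ ∧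
      (∫⁻ x, ENNReal.ofReal (-(f x * Real.log (f x))) ∂μ ≠ ∞ →
        ∫⁻ y, ENNReal.ofReal (-(F y * Real.log (F y))) ∂ν ≠ ∞ ∧
        -(τ.toReal * (2 + Real.log M))
            - ((∫⁻ y, ENNReal.ofReal (F y * Real.log (F y)) ∂ν).toReal
              - (∫⁻ y, ENNReal.ofReal (-(F y * Real.log (F y))) ∂ν).toReal)
          ≤ (∫⁻ x, ENNReal.ofReal (-(f x * Real.log (f x))) ∂μ).toReal
            - (∫⁻ x, ENNReal.ofReal (f x * Real.log (f x)) ∂μ).toReal) := by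
  set k : X → ℝ := fun x => f x * Real.log (f x) - f x * Real.log M with hk
  have hscale : ∀ g : X → ℝ, Measurable g →
      ∫⁻ x, ENNReal.ofReal (g x) ∂(ENNReal.ofReal M • μ)
        = ∫⁻ x, ENNReal.ofReal (M * g x) ∂μ := by
    intro g hg
    rw [lintegral_smul_measure, smul_eq_mul, ← lintegral_const_mul _ hg.ennreal_ofReal]
    simp_rw [ENNReal.ofReal_mul hM.le]
  have hum : Measurable fun x => f x / M := hf.div_const M
  have hul : Measurable fun x => f x / M * Real.log (f x / M) :=
    hum.mul (Real.measurable_log.comp hum)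
  have hfl : Measurable fun x => f x * Real.log (f x) := hf.mul (Real.measurable_log.comp hf)
  -- Dividing f by M and multiplying the measure by M preserves the mass and reduces `key` to M = 1.
  obtain ⟨h1, h2⟩ := entropy_comparison (μ := ENNReal.ofReal M • μ) hum hF
    (fun x => div_nonneg (hf0 x) hM.le) hF0 hτ
    (by
      rw [hscale _ hum, ← hfτ]
      exact lintegral_congr fun x => by rw [mul_div_cancel₀ _ hM.ne'])
    hFτ
    (by
      intro s hs
      have hm : Measurable fun x => sqrtGap (f x / M) s :=
        measurable_sqrtGap.comp (hum.prodMk measurable_const)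
      rw [hscale _ hm]
      refine le_of_eq_of_le (lintegral_congr fun x => ?_) (key s hs)
      rw [sqrtGap_div hM, mul_div_cancel₀ _ hM.ne'])
  have hpos : ∫⁻ x, ENNReal.ofReal (f x / M * Real.log (f x / M)) ∂(ENNReal.ofReal M • μ)
      = ∫⁻ x, ENNReal.ofReal (k x) ∂μ := by
    rw [hscale _ hul]
    exact lintegral_congr fun x => by rw [mul_div_mul_log_div hM]
  have hneg : ∫⁻ x, ENNReal.ofReal (-(f x / M * Real.log (f x / M))) ∂(ENNReal.ofReal M • μ)
      = ∫⁻ x, ENNReal.ofReal (-k x) ∂μ := by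
    have hm : Measurable fun x => -(f x / M * Real.log (f x / M)) := hul.neg
    rw [hscale _ hm]
    exact lintegral_congr fun x => by rw [mul_neg, mul_div_mul_log_div hM]
  rw [hpos] at h1
  rw [hpos, hneg] at h2
  have h3τ : 3 * τ ≠ ∞ := ENNReal.mul_ne_top (by simp) hτ
  have hkpos : ∫⁻ x, ENNReal.ofReal (k x) ∂μ ≠ ∞ :=
    ne_top_of_le_ne_top (ENNReal.add_ne_top.2 ⟨hA, h3τ⟩) h1
  have hfi : Integrable f μ := by
    refine ⟨hf.aestronglyMeasurable, ?_⟩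
    rw [hasFiniteIntegral_iff_ofReal (ae_of_all _ hf0), hfτ]
    exact hτ.lt_top
  have hfM : Integrable (fun x => f x * Real.log M) μ := hfi.mul_const _
  have hDfin : ∫⁻ x, ENNReal.ofReal (f x * Real.log (f x)) ∂μ ≠ ∞ := by
    have h3 : ∫⁻ x, ENNReal.ofReal (f x * Real.log (f x)) ∂μ
        ≤ ∫⁻ x, ENNReal.ofReal (k x) ∂μ + ∫⁻ x, ENNReal.ofReal (f x * Real.log M) ∂μ := by
      rw [← lintegral_add_right _ (by fun_prop)]
      refine lintegral_mono fun x => ?_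
      refine le_trans (le_of_eq ?_) ENNReal.ofReal_add_le
      simp [hk]
    exact ne_top_of_le_ne_top
      (ENNReal.add_ne_top.2 ⟨hkpos, hfM.lintegral_lt_top.ne⟩) h3
  refine ⟨hDfin, fun hC => ?_⟩
  have hli : Integrable (fun x => f x * Real.log (f x)) μ := by
    refine ⟨hfl.aestronglyMeasurable, ?_⟩
    rw [hasFiniteIntegral_iff_norm]
    refine lt_of_le_of_lt ?_ (ENNReal.add_lt_top.2 ⟨hDfin.lt_top, hC.lt_top⟩)
    have hm : Measurable fun x => ENNReal.ofReal (-(f x * Real.log (f x))) :=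
      hfl.neg.ennreal_ofReal
    rw [← lintegral_add_right _ hm]
    refine lintegral_mono fun x => ?_
    simp only [Real.norm_eq_abs]
    rcases le_total 0 (f x * Real.log (f x)) with h | h
    · rw [abs_of_nonneg h]
      exact le_self_add
    · rw [abs_of_nonpos h]
      exact le_add_self
  have hki : Integrable k μ := hli.sub hfM
  have hkneg : ∫⁻ x, ENNReal.ofReal (-k x) ∂μ ≠ ∞ := hki.neg.lintegral_lt_top.ne
  have e1 := integral_eq_lintegral_pos_part_sub_lintegral_neg_part hli
  have e2 := integral_eq_lintegral_pos_part_sub_lintegral_neg_part hki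
  have e3 : ∫ x, k x ∂μ = ∫ x, f x * Real.log (f x) ∂μ - τ.toReal * Real.log M := by
    rw [hk, integral_sub hli hfM, integral_mul_const,
      integral_eq_lintegral_of_nonneg_ae (ae_of_all _ hf0) hf.aestronglyMeasurable, hfτ]
  have hB : ∫⁻ y, ENNReal.ofReal (-(F y * Real.log (F y))) ∂ν ≠ ∞ := by
    refine ne_top_of_le_ne_top ?_ ((le_self_add.trans le_self_add).trans h2)
    exact ENNReal.add_ne_top.2 ⟨ENNReal.add_ne_top.2 ⟨hkneg, hA⟩, h3τ⟩
  refine ⟨hB, ?_⟩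
  have h4 := ENNReal.toReal_mono
    (ENNReal.add_ne_top.2 ⟨ENNReal.add_ne_top.2 ⟨hkneg, hA⟩, h3τ⟩) h2
  rw [ENNReal.toReal_add (ENNReal.add_ne_top.2 ⟨hB, hkpos⟩) hτ, ENNReal.toReal_add hB hkpos,
    ENNReal.toReal_add (ENNReal.add_ne_top.2 ⟨hkneg, hA⟩) h3τ, ENNReal.toReal_add hkneg hA,
    ENNReal.toReal_mul, ENNReal.toReal_ofNat] at h4
  linarith

/-- The uncertainty inequality with a bound `M` for the operator norm of the state. -/
theorem spaceEntropy_ge_of_norm_le {n : ℕ}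
    {ρ : Lp ℂ 2 (volume : Measure (EuclideanSpace ℝ (Fin n))) →L[ℂ]
      Lp ℂ 2 (volume : Measure (EuclideanSpace ℝ (Fin n)))} (hρ : IsState ρ)
    (hF : posIntegral (volume.restrict (Ioi (0 : ℝ))) (freqIntegrand n (fourierConj n ρ)) ≠ ∞)
    {M : ℝ} (hM0 : 0 < M) (hM : ‖ρ‖ ≤ M) :
    negIntegral (densityMeasure volume ρ) (spaceIntegrand n ρ) ≠ ∞ ∧
      spaceEntropy n ρ ≥ ((-((opTrace ρ).toReal * (2 + Real.log M)) : ℝ) : EReal)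
        - freqEntropy n (fourierConj n ρ) := by
  have hρ' := fourierConj_isState hρ
  have hlog : Measurable fun x => Real.log (density volume ρ x) :=
    Real.measurable_log.comp (measurable_density ρ)
  have hpos : posIntegral (densityMeasure volume ρ) (spaceIntegrand n ρ)
      = ∫⁻ x, ENNReal.ofReal (-(density volume ρ x * Real.log (density volume ρ x))) := by
    unfold posIntegral spaceIntegrand
    have hm : Measurable fun x => -Real.log (density volume ρ x) := hlog.neg
    rw [lintegral_densityMeasure hρ hm]
    simp_rw [mul_neg]
  have hneg : negIntegral (densityMeasure volume ρ) (spaceIntegrand n ρ)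
      = ∫⁻ x, ENNReal.ofReal (density volume ρ x * Real.log (density volume ρ x)) := by
    unfold negIntegral spaceIntegrand
    simp_rw [neg_neg]
    rw [lintegral_densityMeasure hρ hlog]
  have hfi : freqIntegrand n (fourierConj n ρ) = fun y =>
      distribution n (fourierConj n ρ) y * Real.log (distribution n (fourierConj n ρ) y) := by
    ext y
    exact mul_comm _ _
  have htr : opTrace (fourierConj n ρ) = opTrace ρ :=
    opTrace_unitaryConj (fourierL2 n) hρ.isPositive
  have main := scaled_entropy_comparison (μ := volume) (ν := volume.restrict (Ioi (0 : ℝ)))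
    (measurable_density ρ) (measurable_distribution n (fourierConj n ρ)) (density_nonneg ρ)
    (fun y => ENNReal.toReal_nonneg) hρ.trace_ne_top (lintegral_density hρ)
    ((lintegral_distribution hρ').trans htr) hM0
    (fun s hs => lintegral_sqrtGap_density_le hρ hM hs) (by rwa [hfi] at hF)
  rw [hfi, posIntegral] at hF
  rw [spaceEntropy, freqEntropy, extIntegral, extIntegral, hpos, hneg, hfi, posIntegral,
    negIntegral]
  obtain ⟨hD, hmain⟩ := main
  refine ⟨hD, ?_⟩
  -- If this positive part is infinite, S_x = +∞ and nothing remains. Otherwise the comparison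
  -- forces the negative part of S_F to be finite and all terms are real; hence S_F = -∞ occurs only
  -- when S_x = +∞.
  rcases eq_or_ne (∫⁻ x, ENNReal.ofReal
    (-(density volume ρ x * Real.log (density volume ρ x)))) ∞ with hC | hC
  · rw [hC, ← EReal.coe_ennreal_toReal hD, EReal.coe_ennreal_top, EReal.top_sub_coe]
    exact le_top
  · obtain ⟨hB, h⟩ := hmain hC
    rw [← EReal.coe_ennreal_toReal hD, ← EReal.coe_ennreal_toReal hC,
      ← EReal.coe_ennreal_toReal hB, ← EReal.coe_ennreal_toReal hF]
    exact_mod_cast h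

end StateEntropy

end

theorem mainTheorem4 (n : ℕ)
    (ρ : Lp ℂ 2 (volume : Measure (EuclideanSpace ℝ (Fin n))) →L[ℂ]
      Lp ℂ 2 (volume : Measure (EuclideanSpace ℝ (Fin n))))
    (hρ : StateEntropy.IsState ρ)
    (hF : StateEntropy.posIntegral (volume.restrict (Ioi (0 : ℝ)))
      (StateEntropy.freqIntegrand n (StateEntropy.fourierConj n ρ)) ≠ ∞) :
    StateEntropy.negIntegral (StateEntropy.densityMeasure volume ρ)
        (StateEntropy.spaceIntegrand n ρ) ≠ ∞ ∧
      StateEntropy.spaceEntropy n ρ ≥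
        ((-((StateEntropy.opTrace ρ).toReal * (2 + Real.log ‖ρ‖)) : ℝ) : EReal) -
          StateEntropy.freqEntropy n (StateEntropy.fourierConj n ρ) := by
  -- For ρ = 0 the norm is not an admissible M > 0, but the trace factor vanishes, so M = 1 gives
  -- the same bound.
  rcases eq_or_ne ρ 0 with h0 | h0
  · have h1 : StateEntropy.opTrace ρ = 0 := by simp [h0, StateEntropy.opTrace]
    have h2 := StateEntropy.spaceEntropy_ge_of_norm_le hρ hF zero_lt_one (by simp [h0])
    simpa only [h1, ENNReal.toReal_zero, zero_mul] using h2
  · exact StateEntropy.spaceEntropy_ge_of_norm_le hρ hF (norm_pos_iff.2 h0) le_rfl
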